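/- Customers arrive at a service system according to a renewal process: the interarrival times $U_1,U_2,\dots\ge 0$ are i.i.d. with an arbitrary law of mean $1/\lambda\in(0,\infty)$, and the $n$-th customer arrives at $A_n=U_1+\dots+U_n$. Customer $n$ has a valuation $V_n>0$ and a service time $S_n$; the $V_n$ are i.i.d. with a continuous distribution function $G$ and finite mean, the $S_n$ are i.i.d. exponential with mean $1/\mu\in(0,\infty)$, and all these variables are mutually independent. Put $\overline G=1-G$. The system starts empty and has $K\in\{0,1,2,\dots\}\cup\{\infty\}$ servers. A customer who finds $k<K$ servers busy is charged a price $p_k\in[0,\infty)$; he joins, pays $p_k$ and occupies a free server during his service time if his valuation is at least $p_k$, and is lost otherwise. Customers who find all $K$ servers busy are lost. (If several customers arrive at the same instant, they are served one after the other in the order of their indices.) Let $R(t)$ be the sum of the payments of the customers who arrive until time $t$. For finite $K$ and $\mathbf p\in[0,\infty)^K$ let $$R(K,\mathbf p)=\lim_{t\to\infty}\frac{\mathbb E\,R(t)}{t}$$ be the mean revenue rate, and write $p\mathbf 1$ for the uniform prices $p_k=p$ for all $k$. Then the function $p\mapsto p\,\overline G(p)$ attains its maximum on $[0,\infty)$,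 the limit $R(K,\mathbf p)$ exists for every finite $K$ and every $\mathbf p\in[0,\infty)^K$, and for every maximizer $p^*_\infty\in\arg\max_{p\ge 0}p\,\overline G(p)$ the following hold. 1. For every finite $K$ and every $\mathbf p\in[0,\infty)^K$, $R(K,\mathbf p)\le \lambda\,p^*_\infty\,\overline G(p^*_\infty)$. 2. As $K\to\infty$, both $R(K,p^*_\infty\mathbf 1)$ and the optimal revenue rate $\sup_{\mathbf p\in[0,\infty)^K}R(K,\mathbf p)$ converge to $\lambda\,p^*_\infty\,\overline G(p^*_\infty)$. 3. Uniform pricing at $p^*_\infty$ is optimal for the system with infinitely many servers ($K=\infty$): under the uniform price $p^*_\infty$, $\mathbb E\,R(t)/t\to\lambda\,p^*_\infty\,\overline G(p^*_\infty)$ as $t\to\infty$, whereas under arbitrary state-dependent prices $p_0,p_1,\dots\in[0,\infty)$, $\limsup_{t\to\infty}\mathbb E\,R(t)/t\le\lambda\,p^*_\infty\,\overline G(p^*_\infty)$. -/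

import Mathlib

open MeasureTheory ProbabilityTheory Filter Topology
open scoped NNReal ENNReal

/-- The stochastic input of the service system, on a probability space `(Ω, P)`. Customers are
numbered from `0`; `U n` is the interarrival time preceding customer `n`, `V n` the valuation of
customer `n` and `S n` its service time. All these variables are mutually independent;
interarrival times have a general common law with mean `1 / lam`, valuations have a common
continuous law on the positive reals with finite mean, and service times are exponential with
mean `1 / mu`. -/
structure IsServiceModel {Ω : Type*} [MeasurableSpace Ω] (P : Measure Ω)
    (U V S : ℕ → Ω → ℝ≥0) (lam mu : ℝ≥0) : Prop where
  lam_pos : 0 < lam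
  mu_pos : 0 < mu
  measurable_interarrival : ∀ n, Measurable (U n)
  measurable_valuation : ∀ n, Measurable (V n)
  measurable_service : ∀ n, Measurable (S n)
  indep : iIndepFun (Sum.elim U (Sum.elim V S)) P
  identDistrib_interarrival : ∀ n, IdentDistrib (U n) (U 0) P P
  identDistrib_valuation : ∀ n, IdentDistrib (V n) (V 0) P P
  mean_interarrival : ∫⁻ ω, (U 0 ω : ℝ≥0∞) ∂P = (lam : ℝ≥0∞)⁻¹
  valuation_pos : ∀ᵐ ω ∂P, 0 < V 0 ω
  continuous_valuation : Continuous fun x : ℝ≥0 => P {ω | V 0 ω ≤ x}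
  mean_valuation : ∫⁻ ω, (V 0 ω : ℝ≥0∞) ∂P ≠ ∞
  law_service : ∀ n, P.map (fun ω => (S n ω : ℝ)) = expMeasure (mu : ℝ)

/-- The complementary distribution function `1 - G` of the valuation `W`,
where `G x = P (W ≤ x)`. -/
noncomputable def tailProb {Ω : Type*} [MeasurableSpace Ω] (P : Measure Ω) (W : Ω → ℝ≥0)
    (x : ℝ≥0) : ℝ≥0∞ :=
  1 - P {ω | W ω ≤ x}

/-- The arrival instant of customer `n`, given the interarrival times `u`. -/
noncomputable def arrivalTime (u : ℕ → ℝ≥0) (n : ℕ) : ℝ≥0 :=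
  ∑ i ∈ Finset.range (n + 1), u i

/-- The number of busy servers found by customer `n`, for interarrival times `u`, valuations `v`
and service times `s`, in the system that starts empty and charges the price `p k` when `k` servers
are busy: the number of earlier customers `m` that were admitted, i.e. whose valuation was at least
the price charged to them, and whose service, which occupies `[A m, A m + s m)`, is not over before
the instant `A n`. An infinite price admits nobody. -/
noncomputable def busySeen (p : ℕ → ℝ≥0∞) (u v s : ℕ → ℝ≥0) (n : ℕ) : ℕ :=
  ∑ m : Fin n,
    if p (busySeen p u v s m) ≤ (v m : ℝ≥0∞) ∧ arrivalTime u n ≤ arrivalTime u m + s m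
    then 1 else 0
termination_by n
decreasing_by exact m.2

/-- The payment of customer `n`: the price charged to it if it joins, and `0` otherwise. -/
noncomputable def payment (p : ℕ → ℝ≥0∞) (u v s : ℕ → ℝ≥0) (n : ℕ) : ℝ≥0∞ :=
  if p (busySeen p u v s n) ≤ (v n : ℝ≥0∞) then p (busySeen p u v s n) else 0

/-- The revenue earned until time `t`: the sum of the payments of all customers
that arrive until time `t`. -/
noncomputable def revenue (p : ℕ → ℝ≥0∞) (u v s : ℕ → ℝ≥0) (t : ℝ≥0) : ℝ≥0∞ :=
  ∑' n : ℕ, if arrivalTime u n ≤ t then payment p u v s n else 0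

/-- The expected revenue until time `t`, divided by `t`. -/
noncomputable def averageRevenue {Ω : Type*} [MeasurableSpace Ω] (P : Measure Ω)
    (U V S : ℕ → Ω → ℝ≥0) (p : ℕ → ℝ≥0∞) (t : ℝ≥0) : ℝ≥0∞ :=
  (∫⁻ ω, revenue p (fun n => U n ω) (fun n => V n ω) (fun n => S n ω) t ∂P) / (t : ℝ≥0∞)

/-- The prices of the system with `K` servers and price vector `(p 0, …, p (K - 1))`: the price is
infinite when all `K` servers are busy, so that customers who arrive then are lost. -/
noncomputable def finitePrices (K : ℕ) (p : Fin K → ℝ≥0) (k : ℕ) : ℝ≥0∞ :=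
  if h : k < K then (p ⟨k, h⟩ : ℝ≥0∞) else ∞

/-- The prices of the system with infinitely many servers and price sequence
`p 0, p 1, …`: a finite price is charged in every state, and nobody is blocked. -/
noncomputable def infinitePrices (p : ℕ → ℝ≥0) (k : ℕ) : ℝ≥0∞ := (p k : ℝ≥0∞)

/-- The limiting mean revenue rate of the system with `K` servers and price vector `p`. -/
noncomputable def revenueRate {Ω : Type*} [MeasurableSpace Ω] (P : Measure Ω)
    (U V S : ℕ → Ω → ℝ≥0) (K : ℕ) (p : Fin K → ℝ≥0) : ℝ≥0∞ :=
  limUnder atTop (averageRevenue P U V S (finitePrices K p))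

/-! Upper bound: the valuation of customer `n` is independent of the state it finds and of its
arrival time. Whatever price is charged, its mean payment is thus at most r, the maximum of x times
the tail probability at x. Summing over arrivals and applying the elementary renewal theorem gives
the bound `lam * r` for all prices and any number of servers (`lintegral_payment_le`,
`averageRevenue_le`).

Existence of the limit for finite K: by memorylessness, r given busy servers all survive until the
next arrival with probability β_r = E exp(-r μ U), independently of the past. Hence the r-th
binomial moment of the state found by customer `n + 1` is β_r times that of the state just after
arrival `n` (`lintegral_choose_busySeen_succ`). The matrix of binomial coefficients is
unitriangular, so these moments determine the law of the state, and this law evolves by a fixed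
linear map. A bounded orbit of a linear map in finite dimension converges in the Cesàro sense, which
needs no irreducibility or aperiodicity. The mean payment per customer therefore has a Cesàro limit.

From customers to time: payments and arrival times are dependent, so the revenue until `t` is
compared with that of the first `⌈lam * t⌉₊` customers. The customers on which the two disagree are
o(t) in mean, by a Chernoff bound for the excess and Wald's inequality for the deficit
(`tendsto_lintegral_tsum_div`).

Large K: the case r = 1 bounds the mean number of busy servers by 1/(1 - β_1), uniformly in `n` and
in the prices. By Markov's inequality the blocking probability is O(1/K), and a uniform price loses
nothing else. With infinitely many servers a uniform price loses nothing at all. -/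

/-! ### Resampling a coordinate and integrating out exponential service times -/

/-- Replacing one coordinate of a vector of independent variables by an independent copy does not
change expectations. -/
theorem lintegral_eq_lintegral_update {ι E Ω : Type*} [DecidableEq ι] [MeasurableSpace E]
    [MeasurableSpace Ω] {P : Measure Ω} [IsProbabilityMeasure P] {X : ι → Ω → E}
    (hX : ∀ i, Measurable (X i)) (h : iIndepFun X P) (i : ι) {φ : (ι → E) → ℝ≥0∞}
    (hφ : Measurable φ) :
    ∫⁻ ω, φ (fun j => X j ω) ∂P
      = ∫⁻ ω, ∫⁻ y, φ (Function.update (fun j => X j ω) i y) ∂(P.map (X i)) ∂P := by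
  have hprob : ∀ j, IsProbabilityMeasure (P.map (X j)) := fun j =>
    Measure.isProbabilityMeasure_map (hX j).aemeasurable
  have hmapX : Measurable fun ω j => X j ω := measurable_pi_iff.2 hX
  have hlaw := h.map_fun_eq_infinitePi_map hX
  set ν := Measure.infinitePi fun j => P.map (X j) with hν
  have hup : Measurable fun q : (ι → E) × E => Function.update q.1 i q.2 := by
    refine measurable_pi_iff.2 fun j => ?_
    by_cases hj : j = i
    · subst hj; simpa using measurable_snd
    · simp only [Function.update_of_ne hj]; fun_prop
  -- It suffices to check cylinders over finite sets `s`: the preimage of such a cylinder is a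
  -- rectangle that separates coordinate `i` from `s.erase i`.
  have hinv : (ν.prod (P.map (X i))).map (fun q => Function.update q.1 i q.2) = ν := by
    refine Measure.eq_infinitePi _ fun s t ht => ?_
    rw [Measure.map_apply hup (MeasurableSet.pi s.countable_toSet fun j _ => ht j)]
    have hpre : (fun q : (ι → E) × E => Function.update q.1 i q.2) ⁻¹' Set.pi s t
        = Set.pi (s.erase i : Finset ι) t ×ˢ {y | i ∈ s → y ∈ t i} := by
      ext ⟨x, y⟩
      simp only [Set.mem_preimage, Set.mem_pi, Set.mem_prod, Finset.coe_erase, Set.mem_ofPred_eq,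
        Set.mem_sdiff, Set.mem_singleton_iff, Finset.mem_coe]
      constructor
      · refine fun hx => ⟨fun j hj => ?_, fun hi => by simpa using hx i hi⟩
        simpa [Function.update_of_ne hj.2] using hx j hj.1
      · rintro ⟨hx, hy⟩ j hj
        by_cases hji : j = i
        · subst hji; simpa using hy hj
        · simpa [Function.update_of_ne hji] using hx j ⟨hj, hji⟩
    rw [hpre, Measure.prod_prod, hν, Measure.infinitePi_pi _ fun j _ => ht j]
    by_cases hi : i ∈ s
    · simp [hi, Finset.prod_erase_mul]
    · simp [hi]
  calc ∫⁻ ω, φ (fun j => X j ω) ∂P = ∫⁻ x, φ x ∂ν := by rw [← hlaw, lintegral_map hφ hmapX]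
    _ = ∫⁻ q, φ (Function.update q.1 i q.2) ∂(ν.prod (P.map (X i))) := by
        rw [← lintegral_map hφ hup, hinv]
    _ = ∫⁻ x, ∫⁻ y, φ (Function.update x i y) ∂(P.map (X i)) ∂ν :=
        lintegral_prod _ (hφ.comp hup).aemeasurable
    _ = _ := by
        rw [← hlaw, lintegral_map _ hmapX]
        exact (hφ.comp hup).lintegral_prod_right'

/-- An r-subset of the elements satisfying `q` is an r-subset of `s` all of whose members satisfy
`q`. This turns a binomial moment of the number of busy servers into a sum of probabilities that a
prescribed set of customers is in service. -/
theorem Finset.cast_sum_choose_eq_sum_powersetCard {α R : Type*} [CommSemiring R] (s : Finset α)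
    (q : α → Prop) [DecidablePred q] (r : ℕ) :
    (((∑ m ∈ s, if q m then 1 else 0 : ℕ).choose r : ℕ) : R)
      = ∑ c ∈ s.powersetCard r, ∏ m ∈ c, if q m then (1 : R) else 0 := by
  classical
  rw [← Finset.card_filter, ← Finset.card_powersetCard, Finset.card_eq_sum_ones, Nat.cast_sum]
  have : (s.filter q).powersetCard r = (s.powersetCard r).filter fun c => ∀ m ∈ c, q m := by
    ext c
    simp only [Finset.mem_powersetCard, Finset.mem_filter, Finset.subset_iff]
    constructor
    · rintro ⟨h, hc⟩; exact ⟨⟨fun x hx => (h hx).1, hc⟩, fun x hx => (h hx).2⟩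
    · rintro ⟨⟨h, hc⟩, h'⟩; exact ⟨fun x hx => ⟨h hx, h' x hx⟩, hc⟩
  rw [this, Finset.sum_filter]
  refine Finset.sum_congr rfl fun c _ => ?_
  rw [Finset.prod_ite_zero]
  simp

/-- The survival function of the exponential law with rate `mu`. -/
noncomputable def expTail (mu x : ℝ≥0) : ℝ≥0∞ := ENNReal.ofReal (Real.exp (-(mu * x)))

theorem measurable_expTail (mu : ℝ≥0) : Measurable (expTail mu) := by
  unfold expTail; fun_prop

theorem expTail_add (mu x y : ℝ≥0) : expTail mu (x + y) = expTail mu x * expTail mu y := by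
  rw [expTail, expTail, expTail, ← ENNReal.ofReal_mul (Real.exp_pos _).le, ← Real.exp_add]
  congr 2; push_cast; ring

theorem expTail_le_one (mu x : ℝ≥0) : expTail mu x ≤ 1 := by
  rw [expTail, ENNReal.ofReal_le_one, Real.exp_le_one_iff]
  have := mul_nonneg mu.2 x.2
  simpa using this

theorem expMeasure_Ici {r x : ℝ} (hr : 0 < r) (hx : 0 ≤ x) :
    expMeasure r (Set.Ici x) = ENNReal.ofReal (Real.exp (-(r * x))) := by
  have := isProbabilityMeasure_expMeasure hr
  have hna : NullSingletonClass (expMeasure r) :=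
    ⟨fun y => withDensity_absolutelyContinuous _ _ (measure_singleton y)⟩
  rw [← Set.compl_Iio, prob_compl_eq_one_sub measurableSet_Iio,
    measure_congr (Iio_ae_eq_Iic (μ := expMeasure r) (a := x)), ← ofReal_cdf, cdf_expMeasure_eq hr,
    if_pos hx, ← ENNReal.ofReal_one, ← ENNReal.ofReal_sub]
  · congr 1; ring
  · rw [sub_nonneg, Real.exp_le_one_iff]; have := mul_nonneg hr.le hx; linarith

theorem IsServiceModel.measurable_input {Ω : Type*} [MeasurableSpace Ω] {P : Measure Ω}
    {U V S : ℕ → Ω → ℝ≥0} {lam mu : ℝ≥0} (h : IsServiceModel P U V S lam mu) (i : ℕ ⊕ ℕ ⊕ ℕ) :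
    Measurable (Sum.elim U (Sum.elim V S) i) := by
  rcases i with i | i | i
  · exact h.measurable_interarrival i
  · exact h.measurable_valuation i
  · exact h.measurable_service i

theorem IsServiceModel.map_service_Ici {Ω : Type*} [MeasurableSpace Ω] {P : Measure Ω}
    {U V S : ℕ → Ω → ℝ≥0} {lam mu : ℝ≥0} (h : IsServiceModel P U V S lam mu) (n : ℕ) (g : ℝ≥0) :
    P.map (S n) (Set.Ici g) = expTail mu g := by
  rw [expTail, ← expMeasure_Ici (by exact_mod_cast h.mu_pos) g.coe_nonneg, ← h.law_service n,
    Measure.map_apply (h.measurable_service n) measurableSet_Ici,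
    Measure.map_apply (h.measurable_service n).coe_nnreal_real measurableSet_Ici]
  rfl

/-- The whole input of the system at the sample point `ω`. -/
def inputAt {Ω : Type*} (U V S : ℕ → Ω → ℝ≥0) (ω : Ω) : ℕ ⊕ ℕ ⊕ ℕ → ℝ≥0 :=
  fun i => Sum.elim U (Sum.elim V S) i ω

theorem IsServiceModel.measurable_inputAt {Ω : Type*} [MeasurableSpace Ω] {P : Measure Ω}
    {U V S : ℕ → Ω → ℝ≥0} {lam mu : ℝ≥0} (h : IsServiceModel P U V S lam mu) :
    Measurable (inputAt U V S) :=
  measurable_pi_iff.2 h.measurable_input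

/-- Independent exponential service times can be integrated out against anything that does not
depend on them. -/
theorem IsServiceModel.lintegral_mul_prod_survive {Ω : Type*} [MeasurableSpace Ω] {P : Measure Ω}
    [IsProbabilityMeasure P] {U V S : ℕ → Ω → ℝ≥0} {lam mu : ℝ≥0}
    (h : IsServiceModel P U V S lam mu) (c : Finset ℕ) {F : (ℕ ⊕ ℕ ⊕ ℕ → ℝ≥0) → ℝ≥0∞}
    {g : ℕ → (ℕ ⊕ ℕ ⊕ ℕ → ℝ≥0) → ℝ≥0} (hF : Measurable F) (hg : ∀ m, Measurable (g m))
    (hFc : ∀ k ∈ c, ∀ x y, F (Function.update x (.inr (.inr k)) y) = F x)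
    (hgc : ∀ k ∈ c, ∀ m x y, g m (Function.update x (.inr (.inr k)) y) = g m x) :
    ∫⁻ ω, F (inputAt U V S ω)
        * ∏ m ∈ c, (if g m (inputAt U V S ω) ≤ S m ω then (1 : ℝ≥0∞) else 0) ∂P
      = ∫⁻ ω, F (inputAt U V S ω) * ∏ m ∈ c, expTail mu (g m (inputAt U V S ω)) ∂P := by
  classical
  -- `F` is generalized because each step absorbs into it the factor `expTail mu (g k)` just
  -- produced.
  induction c using Finset.induction_on generalizing F with
  | empty => simp
  | insert k c hk ih =>
    have hind : ∀ m, Measurable fun x : ℕ ⊕ ℕ ⊕ ℕ → ℝ≥0 =>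
        if g m x ≤ x (.inr (.inr m)) then (1 : ℝ≥0∞) else 0 := fun m =>
      Measurable.ite (measurableSet_le (hg m) (measurable_pi_apply _)) measurable_const
        measurable_const
    have hprod : Measurable fun x : ℕ ⊕ ℕ ⊕ ℕ → ℝ≥0 =>
        ∏ m ∈ c, (if g m x ≤ x (.inr (.inr m)) then (1 : ℝ≥0∞) else 0) :=
      Finset.measurable_prod _ fun m _ => hind m
    have hstep := lintegral_eq_lintegral_update h.measurable_input h.indep (.inr (.inr k))
      (φ := fun x => (F x * ∏ m ∈ c, (if g m x ≤ x (.inr (.inr m)) then (1 : ℝ≥0∞) else 0))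
        * if g k x ≤ x (.inr (.inr k)) then (1 : ℝ≥0∞) else 0) ((hF.mul hprod).mul (hind k))
    have hIH := ih (F := fun x => F x * expTail mu (g k x))
      (hF.mul ((measurable_expTail mu).comp (hg k)))
      (fun j hj x y => by
        rw [hFc j (Finset.mem_insert_of_mem hj), hgc j (Finset.mem_insert_of_mem hj)])
      (fun j hj => hgc j (Finset.mem_insert_of_mem hj))
    calc _ = ∫⁻ ω, (F (inputAt U V S ω)
          * ∏ m ∈ c, (if g m (inputAt U V S ω) ≤ S m ω then (1 : ℝ≥0∞) else 0))
          * (if g k (inputAt U V S ω) ≤ S k ω then (1 : ℝ≥0∞) else 0) ∂P := by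
          refine lintegral_congr fun ω => ?_
          rw [Finset.prod_insert hk]; ring
      _ = ∫⁻ ω, (F (inputAt U V S ω)
          * ∏ m ∈ c, (if g m (inputAt U V S ω) ≤ S m ω then (1 : ℝ≥0∞) else 0))
          * expTail mu (g k (inputAt U V S ω)) ∂P := by
          refine hstep.trans (lintegral_congr fun ω => ?_)
          simp only [hFc k (Finset.mem_insert_self k c), hgc k (Finset.mem_insert_self k c),
            Function.update_self]
          have hrest : ∀ y, ∏ m ∈ c, (if g m (fun j => Sum.elim U (Sum.elim V S) j ω)
                ≤ Function.update (fun j => Sum.elim U (Sum.elim V S) j ω) (.inr (.inr k)) y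
                  (.inr (.inr m)) then (1 : ℝ≥0∞) else 0)
              = ∏ m ∈ c, (if g m (inputAt U V S ω) ≤ S m ω then (1 : ℝ≥0∞) else 0) := by
            refine fun y => Finset.prod_congr rfl fun m hm => ?_
            rw [Function.update_of_ne (by simp; rintro rfl; exact hk hm)]
            rfl
          simp only [hrest]
          rw [lintegral_const_mul _ (Measurable.ite measurableSet_Ici measurable_const
            measurable_const)]
          congr 1
          rw [← h.map_service_Ici k, ← lintegral_indicator_one measurableSet_Ici]
          rfl
      _ = _ := by
          rw [← lintegral_congr fun ω => ?_] at hIH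
          · exact hIH.trans (lintegral_congr fun ω => by rw [Finset.prod_insert hk]; ring)
          · ring

/-! ### Pathwise properties of the number of busy servers -/

theorem arrivalTime_succ (u : ℕ → ℝ≥0) (n : ℕ) :
    arrivalTime u (n + 1) = arrivalTime u n + u (n + 1) :=
  Finset.sum_range_succ _ _

theorem arrivalTime_mono (u : ℕ → ℝ≥0) : Monotone (arrivalTime u) :=
  monotone_nat_of_le_succ fun n => by rw [arrivalTime_succ]; exact le_self_add

theorem arrivalTime_congr {u u' : ℕ → ℝ≥0} {n : ℕ} (h : ∀ i ≤ n, u i = u' i) :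
    arrivalTime u n = arrivalTime u' n :=
  Finset.sum_congr rfl fun i hi => h i (Nat.lt_succ_iff.1 (Finset.mem_range.1 hi))

theorem busySeen_eq_sum_range (p : ℕ → ℝ≥0∞) (u v s : ℕ → ℝ≥0) (n : ℕ) :
    busySeen p u v s n = ∑ m ∈ Finset.range n,
      if p (busySeen p u v s m) ≤ (v m : ℝ≥0∞) ∧ arrivalTime u n ≤ arrivalTime u m + s m
      then 1 else 0 := by
  rw [busySeen, Finset.sum_range]

/-- The number of busy servers is determined by the earlier input, and it does not matter how long
a service lasts that is not over yet. -/
theorem busySeen_congr {p : ℕ → ℝ≥0∞} {u u' v v' s s' : ℕ → ℝ≥0} {n : ℕ}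
    (hu : ∀ i ≤ n, u i = u' i) (hv : ∀ i < n, v i = v' i)
    (hs : ∀ i < n, s i = s' i ∨
      arrivalTime u n ≤ arrivalTime u i + s i ∧ arrivalTime u n ≤ arrivalTime u i + s' i) :
    busySeen p u v s n = busySeen p u' v' s' n := by
  -- The hypothesis on service times is stated at `n` but passes to every `k ≤ n`, since a service
  -- lasting until arrival `n` also covers arrival `k`.
  suffices H : ∀ k ≤ n, busySeen p u v s k = busySeen p u' v' s' k from H n le_rfl
  intro k
  induction k using Nat.strong_induction_on with
  | _ k ih =>
    intro hk
    rw [busySeen_eq_sum_range, busySeen_eq_sum_range]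
    refine Finset.sum_congr rfl fun m hm => ?_
    have hmk : m < k := Finset.mem_range.1 hm
    rw [ih m hmk (by omega), hv m (by omega),
      ← arrivalTime_congr (u := u) (u' := u') fun i hi => hu i (hi.trans hk),
      ← arrivalTime_congr (u := u) (u' := u') (n := m) fun i hi => hu i (by omega)]
    rcases hs m (by omega) with h | ⟨h, h'⟩
    · rw [h]
    · have := arrivalTime_mono u hk
      simp only [this.trans h, this.trans h']

/-- The number of busy servers just after the arrival of customer `n`. -/
theorem sum_range_succ_busy (p : ℕ → ℝ≥0∞) (u v s : ℕ → ℝ≥0) (n : ℕ) :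
    (∑ m ∈ Finset.range (n + 1),
      if p (busySeen p u v s m) ≤ (v m : ℝ≥0∞) ∧ arrivalTime u n ≤ arrivalTime u m + s m
      then 1 else 0)
      = busySeen p u v s n + if p (busySeen p u v s n) ≤ (v n : ℝ≥0∞) then 1 else 0 := by
  rw [Finset.sum_range_succ, ← busySeen_eq_sum_range]
  -- Customer `n` counts itself exactly when admitted: the remaining condition is a weak inequality
  -- that holds even for a zero service time.
  simp

theorem busySeen_succ_le (p : ℕ → ℝ≥0∞) (u v s : ℕ → ℝ≥0) (n : ℕ) :
    busySeen p u v s (n + 1)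
      ≤ busySeen p u v s n + if p (busySeen p u v s n) ≤ (v n : ℝ≥0∞) then 1 else 0 := by
  rw [← sum_range_succ_busy, busySeen_eq_sum_range]
  refine Finset.sum_le_sum fun m _ => ?_
  by_cases h : p (busySeen p u v s m) ≤ (v m : ℝ≥0∞)
      ∧ arrivalTime u (n + 1) ≤ arrivalTime u m + s m
  · rw [if_pos h, if_pos ⟨h.1, (arrivalTime_mono u n.le_succ).trans h.2⟩]
  · rw [if_neg h]; exact Nat.zero_le _

theorem busySeen_le {p : ℕ → ℝ≥0∞} {K : ℕ} (hp : ∀ k, K ≤ k → p k = ∞) (u v s : ℕ → ℝ≥0)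
    (n : ℕ) : busySeen p u v s n ≤ K := by
  induction n with
  | zero => rw [busySeen_eq_sum_range]; simp
  | succ n ih =>
    refine (busySeen_succ_le p u v s n).trans ?_
    split_ifs with h
    · by_contra hK
      rw [hp _ (by omega)] at h
      simp at h
    · simpa using ih

/-- `busySeen` as a function of the whole input. -/
noncomputable abbrev seen (p : ℕ → ℝ≥0∞) (x : ℕ ⊕ ℕ ⊕ ℕ → ℝ≥0) (n : ℕ) : ℕ :=
  busySeen p (fun i => x (.inl i)) (fun i => x (.inr (.inl i))) (fun i => x (.inr (.inr i))) n

theorem measurable_arrivalTime (n : ℕ) :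
    Measurable fun x : ℕ ⊕ ℕ ⊕ ℕ → ℝ≥0 => arrivalTime (fun i => x (.inl i)) n := by
  unfold arrivalTime; fun_prop

theorem measurable_busySeen_comp {α : Type*} [MeasurableSpace α] (p : ℕ → ℝ≥0∞)
    {u v s : ℕ → α → ℝ≥0} (hu : ∀ i, Measurable (u i)) (hv : ∀ i, Measurable (v i))
    (hs : ∀ i, Measurable (s i)) (n : ℕ) :
    Measurable fun a => busySeen p (fun i => u i a) (fun i => v i a) (fun i => s i a) n := by
  have hA : ∀ k, Measurable fun a => arrivalTime (fun i => u i a) k := fun k => by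
    unfold arrivalTime; fun_prop
  induction n using Nat.strong_induction_on with
  | _ n ih =>
    simp only [busySeen_eq_sum_range p _ _ _ n]
    refine Finset.measurable_sum _ fun m hm => Measurable.ite ?_ measurable_const measurable_const
    have h1 : Measurable fun a =>
        p (busySeen p (fun i => u i a) (fun i => v i a) (fun i => s i a) m) :=
      (Measurable.of_discrete (f := p)).comp (ih m (Finset.mem_range.1 hm))
    exact (measurableSet_le h1 (hv m).coe_nnreal_ennreal).inter
      (measurableSet_le (f := fun a => arrivalTime (fun i => u i a) n) (hA n) ((hA m).add (hs m)))

theorem measurable_coord (i : ℕ ⊕ ℕ ⊕ ℕ) : Measurable fun x : ℕ ⊕ ℕ ⊕ ℕ → ℝ≥0 => x i :=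
  measurable_pi_apply i

theorem measurable_seen (p : ℕ → ℝ≥0∞) (n : ℕ) :
    Measurable fun x : ℕ ⊕ ℕ ⊕ ℕ → ℝ≥0 => seen p x n :=
  measurable_busySeen_comp p (u := fun i (x : ℕ ⊕ ℕ ⊕ ℕ → ℝ≥0) => x (.inl i))
    (v := fun i x => x (.inr (.inl i))) (s := fun i x => x (.inr (.inr i)))
    (fun _ => measurable_coord _) (fun _ => measurable_coord _) (fun _ => measurable_coord _) n

theorem IsServiceModel.isProbabilityMeasure {Ω : Type*} [MeasurableSpace Ω] {P : Measure Ω}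
    {U V S : ℕ → Ω → ℝ≥0} {lam mu : ℝ≥0} (h : IsServiceModel P U V S lam mu) :
    IsProbabilityMeasure P := h.indep.isProbabilityMeasure

/-- Independence in a pathwise form: instead of measurability with respect to the other coordinates,
it is enough that `F` ignores changes of coordinate `i`. -/
theorem IsServiceModel.lintegral_mul_of_update_eq {Ω : Type*} [MeasurableSpace Ω] {P : Measure Ω}
    {U V S : ℕ → Ω → ℝ≥0} {lam mu : ℝ≥0} (h : IsServiceModel P U V S lam mu) (i : ℕ ⊕ ℕ ⊕ ℕ)
    {F : (ℕ ⊕ ℕ ⊕ ℕ → ℝ≥0) → ℝ≥0∞} (hF : Measurable F)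
    (hFi : ∀ x y, F (Function.update x i y) = F x) {f : ℝ≥0 → ℝ≥0∞} (hf : Measurable f) :
    ∫⁻ ω, F (inputAt U V S ω) * f (inputAt U V S ω i) ∂P
      = (∫⁻ ω, F (inputAt U V S ω) ∂P) * ∫⁻ ω, f (inputAt U V S ω i) ∂P := by
  have := h.isProbabilityMeasure
  have hstep := lintegral_eq_lintegral_update h.measurable_input h.indep i
    (φ := fun x => F x * f (x i)) (hF.mul (hf.comp (measurable_pi_apply i)))
  refine hstep.trans ?_
  simp only [hFi, Function.update_self]
  simp_rw [lintegral_const_mul _ hf]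
  refine (lintegral_mul_const _ (hF.comp h.measurable_inputAt)).trans ?_
  rw [lintegral_map hf (h.measurable_input i)]
  rfl

/-! ### Recursion for the binomial moments -/

/-- The probability that `r` given busy servers are all still busy at the next arrival. -/
noncomputable def surviveProb {Ω : Type*} [MeasurableSpace Ω] (P : Measure Ω) (U : ℕ → Ω → ℝ≥0)
    (mu : ℝ≥0) (r : ℕ) : ℝ≥0∞ :=
  ∫⁻ ω, expTail mu (U 0 ω) ^ r ∂P

/-- The service times, with those of the customers in `c` prolonged beyond the arrival of
customer `n`. -/
noncomputable def prolonged (c : Finset ℕ) (n : ℕ) (x : ℕ ⊕ ℕ ⊕ ℕ → ℝ≥0) (m : ℕ) : ℝ≥0 :=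
  if m ∈ c then arrivalTime (fun i => x (.inl i)) n else x (.inr (.inr m))

/-- The indicator of the event that all customers in `c` are admitted when their service times are
prolonged. -/
noncomputable def admittedProlonged (p : ℕ → ℝ≥0∞) (c : Finset ℕ) (n : ℕ)
    (x : ℕ ⊕ ℕ ⊕ ℕ → ℝ≥0) : ℝ≥0∞ :=
  ∏ m ∈ c, if p (busySeen p (fun i => x (.inl i)) (fun i => x (.inr (.inl i)))
    (prolonged c n x) m) ≤ x (.inr (.inl m)) then 1 else 0

theorem measurable_admittedProlonged (p : ℕ → ℝ≥0∞) (c : Finset ℕ) (n : ℕ) :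
    Measurable (admittedProlonged p c n) := by
  refine Finset.measurable_prod _ fun m _ => Measurable.ite ?_ measurable_const measurable_const
  refine measurableSet_le ((Measurable.of_discrete (f := p)).comp ?_)
    (measurable_coord _).coe_nnreal_ennreal
  refine measurable_busySeen_comp p (u := fun i x => x (.inl i)) (v := fun i x => x (.inr (.inl i)))
    (s := fun i x => prolonged c n x i)
    (fun _ => measurable_coord _) (fun _ => measurable_coord _) (fun i => ?_) m
  unfold prolonged
  split_ifs
  · exact measurable_arrivalTime n
  · exact measurable_pi_apply _

/-- If all customers in `c` are still in service at arrival `j`, prolonging their services up to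
arrival `n` changes no state seen up to then. The admission indicators can thus be replaced by ones
that do not involve the service times of `c`. If some service in `c` is over earlier, both sides
vanish. -/
theorem prod_busy_eq (p : ℕ → ℝ≥0∞) {c : Finset ℕ} {n j : ℕ} (hc : c ⊆ Finset.range (n + 1))
    (hj : n ≤ j) (x : ℕ ⊕ ℕ ⊕ ℕ → ℝ≥0) :
    (∏ m ∈ c, if p (seen p x m) ≤ (x (.inr (.inl m)) : ℝ≥0∞) ∧
        arrivalTime (fun i => x (.inl i)) j
          ≤ arrivalTime (fun i => x (.inl i)) m + x (.inr (.inr m)) then (1 : ℝ≥0∞) else 0)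
      = admittedProlonged p c n x * ∏ m ∈ c,
        if arrivalTime (fun i => x (.inl i)) j - arrivalTime (fun i => x (.inl i)) m
          ≤ x (.inr (.inr m)) then (1 : ℝ≥0∞) else 0 := by
  rw [admittedProlonged, ← Finset.prod_mul_distrib]
  simp only [tsub_le_iff_left]
  by_cases hall : ∀ m ∈ c, arrivalTime (fun i => x (.inl i)) j
          ≤ arrivalTime (fun i => x (.inl i)) m + x (.inr (.inr m))
  · refine Finset.prod_congr rfl fun m hm => ?_
    have hmn : m ≤ n := Nat.lt_succ_iff.1 (Finset.mem_range.1 (hc hm))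
    have : seen p x m = busySeen p (fun i => x (.inl i)) (fun i => x (.inr (.inl i)))
        (prolonged c n x) m := by
      refine busySeen_congr (fun _ _ => rfl) (fun _ _ => rfl) fun i _ => ?_
      by_cases hi : i ∈ c
      · refine .inr ⟨(arrivalTime_mono _ (hmn.trans hj)).trans (hall i hi), ?_⟩
        rw [prolonged, if_pos hi]
        exact (arrivalTime_mono _ hmn).trans le_add_self
      · exact .inl (by rw [prolonged, if_neg hi])
    rw [← this]
    simp [hall m hm]
  · push Not at hall
    obtain ⟨m, hm, hlt⟩ := hall
    rw [Finset.prod_eq_zero hm, Finset.prod_eq_zero hm]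
    · simp [not_le.2 hlt]
    · simp [not_le.2 hlt]

/-- After `prod_busy_eq` the service times of `c` integrate out to exponential tails at the ages of
the customers. Passing from arrival `n` to arrival `n + 1` multiplies each tail by `expTail mu` of
the same new interarrival time, which is independent of all the rest. -/
theorem IsServiceModel.lintegral_prod_busy_succ {Ω : Type*} [MeasurableSpace Ω] {P : Measure Ω}
    {U V S : ℕ → Ω → ℝ≥0} {lam mu : ℝ≥0} (h : IsServiceModel P U V S lam mu) (p : ℕ → ℝ≥0∞)
    {c : Finset ℕ} {n : ℕ} (hc : c ⊆ Finset.range (n + 1)) :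
    ∫⁻ ω, ∏ m ∈ c, (if p (seen p (inputAt U V S ω) m) ≤ V m ω ∧
        arrivalTime (fun i => U i ω) (n + 1) ≤ arrivalTime (fun i => U i ω) m + S m ω
        then (1 : ℝ≥0∞) else 0) ∂P
      = surviveProb P U mu c.card * ∫⁻ ω, ∏ m ∈ c,
        (if p (seen p (inputAt U V S ω) m) ≤ V m ω ∧
          arrivalTime (fun i => U i ω) n ≤ arrivalTime (fun i => U i ω) m + S m ω
          then (1 : ℝ≥0∞) else 0) ∂P := by
  have := h.isProbabilityMeasure
  have hmeas := measurable_admittedProlonged p c n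
  have hc' : ∀ m ∈ c, m ≤ n := fun m hm => Nat.lt_succ_iff.1 (Finset.mem_range.1 (hc hm))
  have key : ∀ j, n ≤ j → ∫⁻ ω, ∏ m ∈ c,
      (if p (seen p (inputAt U V S ω) m) ≤ V m ω ∧ arrivalTime (fun i => U i ω) j
        ≤ arrivalTime (fun i => U i ω) m + S m ω then (1 : ℝ≥0∞) else 0) ∂P
      = ∫⁻ ω, admittedProlonged p c n (inputAt U V S ω) * ∏ m ∈ c, expTail mu
          (arrivalTime (fun i => U i ω) j - arrivalTime (fun i => U i ω) m) ∂P := by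
    intro j hj
    have := h.lintegral_mul_prod_survive c (F := admittedProlonged p c n)
      (g := fun m x => arrivalTime (fun i => x (.inl i)) j - arrivalTime (fun i => x (.inl i)) m)
      hmeas (fun m => (measurable_arrivalTime j).sub (measurable_arrivalTime m))
      (fun k hk x y => ?_) (fun k hk m x y => by simp)
    · refine Eq.trans ?_ this
      exact lintegral_congr fun ω => prod_busy_eq p hc hj (inputAt U V S ω)
    · have hpro : prolonged c n (Function.update x (.inr (.inr k)) y) = prolonged c n x := by
        ext m
        unfold prolonged
        split_ifs with hm
        · simp
        · rw [Function.update_of_ne (by simp; rintro rfl; exact hm hk)]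
      unfold admittedProlonged
      rw [hpro]
      simp
  refine (key (n + 1) n.le_succ).trans ?_
  refine Eq.trans ?_ (congrArg (surviveProb P U mu c.card * ·) (key n le_rfl).symm)
  have hsplit : ∀ ω, admittedProlonged p c n (inputAt U V S ω) * ∏ m ∈ c, expTail mu
        (arrivalTime (fun i => U i ω) (n + 1) - arrivalTime (fun i => U i ω) m)
      = (admittedProlonged p c n (inputAt U V S ω) * ∏ m ∈ c, expTail mu
        (arrivalTime (fun i => U i ω) n - arrivalTime (fun i => U i ω) m))
        * expTail mu (inputAt U V S ω (.inl (n + 1))) ^ c.card := by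
    intro ω
    rw [mul_assoc, ← Finset.prod_const, ← Finset.prod_mul_distrib]
    congr 1
    refine Finset.prod_congr rfl fun m hm => ?_
    rw [← expTail_add, arrivalTime_succ,
      tsub_add_eq_add_tsub (arrivalTime_mono _ (hc' m hm))]
    rfl
  simp only [hsplit]
  rw [mul_comm, surviveProb]
  have hindep := h.lintegral_mul_of_update_eq (.inl (n + 1))
    (F := fun x => admittedProlonged p c n x * ∏ m ∈ c, expTail mu
      (arrivalTime (fun i => x (.inl i)) n - arrivalTime (fun i => x (.inl i)) m))
    (hmeas.mul (Finset.measurable_prod _ fun m _ => (measurable_expTail mu).comp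
      ((measurable_arrivalTime n).sub (measurable_arrivalTime m)))) (fun x y => ?_)
    (f := fun y => expTail mu y ^ c.card) ((measurable_expTail mu).pow_const _)
  · refine hindep.trans ?_
    congr 1
    exact ((h.identDistrib_interarrival (n + 1)).comp
      ((measurable_expTail mu).pow_const c.card)).lintegral_eq
  · have hu : ∀ i ≤ n, Function.update x (Sum.inl (n + 1)) y (.inl i) = x (.inl i) := fun i hi =>
      Function.update_of_ne (by simp; omega) _ _
    have harr : ∀ m ≤ n, arrivalTime (fun i => Function.update x (Sum.inl (n + 1)) y (.inl i)) m
        = arrivalTime (fun i => x (.inl i)) m := fun m hm =>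
      arrivalTime_congr fun i hi => hu i (hi.trans hm)
    have hpro : prolonged c n (Function.update x (.inl (n + 1)) y) = prolonged c n x := by
      ext m
      unfold prolonged
      rw [harr n le_rfl]
      simp
    congr 1
    · unfold admittedProlonged
      refine Finset.prod_congr rfl fun m hm => ?_
      rw [hpro, busySeen_congr (v' := fun i => x (.inr (.inl i)))
        (s' := prolonged c n x) (fun i hi => hu i (hi.trans (hc' m hm))) (fun i _ => by simp)
        (fun i _ => .inl rfl)]
      simp
    · exact Finset.prod_congr rfl fun m hm => by rw [harr n le_rfl, harr m (hc' m hm)]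

/-- Sum the survival identity over all r-subsets of the first `n + 1` customers. These include
customer `n` itself, hence the added admission indicator on the right. -/
theorem IsServiceModel.lintegral_choose_busySeen_succ {Ω : Type*} [MeasurableSpace Ω]
    {P : Measure Ω} {U V S : ℕ → Ω → ℝ≥0} {lam mu : ℝ≥0} (h : IsServiceModel P U V S lam mu)
    (p : ℕ → ℝ≥0∞) (n r : ℕ) :
    ∫⁻ ω, ((seen p (inputAt U V S ω) (n + 1)).choose r : ℝ≥0∞) ∂P
      = surviveProb P U mu r * ∫⁻ ω, ((seen p (inputAt U V S ω) n
        + if p (seen p (inputAt U V S ω) n) ≤ V n ω then 1 else 0).choose r : ℝ≥0∞) ∂P := by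
  have hmeas : ∀ j, ∀ c ∈ (Finset.range (n + 1)).powersetCard r, Measurable fun ω =>
      ∏ m ∈ c, (if p (seen p (inputAt U V S ω) m) ≤ V m ω ∧
        arrivalTime (fun i => U i ω) j ≤ arrivalTime (fun i => U i ω) m + S m ω
        then (1 : ℝ≥0∞) else 0) := by
    intro j c _
    refine Finset.measurable_prod _ fun m _ => Measurable.ite ?_ measurable_const measurable_const
    have hA : ∀ k, Measurable fun ω => arrivalTime (fun i => U i ω) k := fun k =>
      (measurable_arrivalTime k).comp h.measurable_inputAt
    exact (measurableSet_le ((Measurable.of_discrete (f := p)).comp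
      ((measurable_seen p m).comp h.measurable_inputAt))
      (h.measurable_valuation m).coe_nnreal_ennreal).inter
      (measurableSet_le (f := fun ω => arrivalTime (fun i => U i ω) j) (hA j)
        ((hA m).add (h.measurable_service m)))
  have h1 : ∀ ω, ((seen p (inputAt U V S ω) (n + 1)).choose r : ℝ≥0∞)
      = ∑ c ∈ (Finset.range (n + 1)).powersetCard r, ∏ m ∈ c,
        (if p (seen p (inputAt U V S ω) m) ≤ V m ω ∧
          arrivalTime (fun i => U i ω) (n + 1) ≤ arrivalTime (fun i => U i ω) m + S m ω
          then (1 : ℝ≥0∞) else 0) := by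
    intro ω
    rw [← Finset.cast_sum_choose_eq_sum_powersetCard, seen, busySeen_eq_sum_range]
    rfl
  have h2 : ∀ ω, ((seen p (inputAt U V S ω) n
        + if p (seen p (inputAt U V S ω) n) ≤ V n ω then 1 else 0).choose r : ℝ≥0∞)
      = ∑ c ∈ (Finset.range (n + 1)).powersetCard r, ∏ m ∈ c,
        (if p (seen p (inputAt U V S ω) m) ≤ V m ω ∧
          arrivalTime (fun i => U i ω) n ≤ arrivalTime (fun i => U i ω) m + S m ω
          then (1 : ℝ≥0∞) else 0) := by
    intro ω
    rw [← Finset.cast_sum_choose_eq_sum_powersetCard]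
    congr 2
    exact (sum_range_succ_busy p _ _ _ n).symm
  simp only [h1, h2]
  rw [lintegral_finsetSum _ (hmeas (n + 1)), lintegral_finsetSum _ (hmeas n), Finset.mul_sum]
  refine Finset.sum_congr rfl fun c hc => ?_
  rw [Finset.mem_powersetCard] at hc
  rw [h.lintegral_prod_busy_succ p hc.1, hc.2]

/-- The valuation of customer `n` is independent of the state found and of whatever does not depend
on it. -/
theorem IsServiceModel.lintegral_mul_busySeen_valuation {Ω : Type*} [MeasurableSpace Ω]
    {P : Measure Ω} {U V S : ℕ → Ω → ℝ≥0} {lam mu : ℝ≥0} (h : IsServiceModel P U V S lam mu)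
    (p : ℕ → ℝ≥0∞) (n : ℕ) {W : (ℕ ⊕ ℕ ⊕ ℕ → ℝ≥0) → ℝ≥0∞} (hW : Measurable W)
    (hWn : ∀ x y, W (Function.update x (.inr (.inl n)) y) = W x) {f : ℕ → ℝ≥0 → ℝ≥0∞}
    (hf : ∀ k, Measurable (f k)) :
    ∫⁻ ω, W (inputAt U V S ω) * f (seen p (inputAt U V S ω) n) (V n ω) ∂P
      = ∑' k, (∫⁻ ω, W (inputAt U V S ω)
          * (if seen p (inputAt U V S ω) n = k then 1 else 0) ∂P) * ∫⁻ ω, f k (V 0 ω) ∂P := by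
  have hind : ∀ k, Measurable fun x : ℕ ⊕ ℕ ⊕ ℕ → ℝ≥0 =>
      W x * (if seen p x n = k then (1 : ℝ≥0∞) else 0) := fun k =>
    hW.mul (Measurable.ite (measurable_seen p n (measurableSet_singleton k)) measurable_const
      measurable_const)
  have hsplit : ∀ ω, W (inputAt U V S ω) * f (seen p (inputAt U V S ω) n) (V n ω)
      = ∑' k, W (inputAt U V S ω) * (if seen p (inputAt U V S ω) n = k then 1 else 0)
        * f k (inputAt U V S ω (.inr (.inl n))) := by
    intro ω
    rw [tsum_eq_single (seen p (inputAt U V S ω) n)]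
    · simp [inputAt]
    · intro k hk
      simp [hk.symm]
  simp only [hsplit]
  refine (lintegral_tsum fun k => (((hind k).mul ((hf k).comp (measurable_coord _))).comp
    h.measurable_inputAt).aemeasurable).trans ?_
  refine tsum_congr fun k => ?_
  refine (h.lintegral_mul_of_update_eq (.inr (.inl n)) (hind k) (fun x y => ?_) (hf k)).trans ?_
  · rw [hWn]
    congr 3
    exact busySeen_congr (fun i _ => by simp) (fun i hi => by
      rw [Function.update_of_ne]; simp; omega) (fun i _ => by simp)
  · congr 1
    exact ((h.identDistrib_valuation n).comp (hf k)).lintegral_eq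

/-- The probability that customer `n` finds `k` busy servers. -/
noncomputable def stateProb {Ω : Type*} [MeasurableSpace Ω] (P : Measure Ω)
    (U V S : ℕ → Ω → ℝ≥0) (p : ℕ → ℝ≥0∞) (n k : ℕ) : ℝ≥0∞ :=
  P {ω | seen p (inputAt U V S ω) n = k}

theorem IsServiceModel.lintegral_busySeen_valuation {Ω : Type*} [MeasurableSpace Ω]
    {P : Measure Ω} {U V S : ℕ → Ω → ℝ≥0} {lam mu : ℝ≥0} (h : IsServiceModel P U V S lam mu)
    {p : ℕ → ℝ≥0∞} {K : ℕ} (hp : ∀ k, K ≤ k → p k = ∞) (n : ℕ) {f : ℕ → ℝ≥0 → ℝ≥0∞}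
    (hf : ∀ k, Measurable (f k)) :
    ∫⁻ ω, f (seen p (inputAt U V S ω) n) (V n ω) ∂P
      = ∑ k : Fin (K + 1), stateProb P U V S p n k * ∫⁻ ω, f k (V 0 ω) ∂P := by
  have := h.lintegral_mul_busySeen_valuation p n (W := fun _ => 1) measurable_const
    (fun _ _ => rfl) hf
  simp only [one_mul] at this
  have hst : ∀ k, ∫⁻ ω, (if seen p (inputAt U V S ω) n = k then (1 : ℝ≥0∞) else 0) ∂P
      = stateProb P U V S p n k := fun k => by
    have hm : MeasurableSet {ω | seen p (inputAt U V S ω) n = k} :=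
      (measurable_seen p n).comp h.measurable_inputAt (measurableSet_singleton k)
    rw [stateProb, ← lintegral_indicator_one hm]
    exact lintegral_congr fun ω => by simp [Set.indicator]
  rw [this, Finset.sum_fin_eq_sum_range, tsum_eq_sum (s := Finset.range (K + 1))]
  · refine Finset.sum_congr rfl fun k hk => ?_
    rw [dif_pos (Finset.mem_range.1 hk), hst]
  · intro k hk
    rw [hst, stateProb]
    have : {ω | seen p (inputAt U V S ω) n = k} = ∅ := by
      ext ω
      have : seen p (inputAt U V S ω) n ≤ K := busySeen_le hp _ _ _ n
      rw [Finset.mem_range] at hk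
      simp only [Set.mem_ofPred_eq, Set.mem_empty_iff_false, iff_false]
      rintro rfl
      omega
    simp [this]

/-- The coefficients on the right do not depend on `n`: the binomial moments of the next state are a
fixed linear function of the current law. -/
theorem IsServiceModel.sum_choose_stateProb_succ {Ω : Type*} [MeasurableSpace Ω]
    {P : Measure Ω} {U V S : ℕ → Ω → ℝ≥0} {lam mu : ℝ≥0} (h : IsServiceModel P U V S lam mu)
    {p : ℕ → ℝ≥0∞} {K : ℕ} (hp : ∀ k, K ≤ k → p k = ∞) (n r : ℕ) :
    ∑ k : Fin (K + 1), stateProb P U V S p (n + 1) k * ((k : ℕ).choose r : ℝ≥0∞)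
      = ∑ k : Fin (K + 1), stateProb P U V S p n k * (surviveProb P U mu r *
        ∫⁻ ω, (((k : ℕ) + if p k ≤ V 0 ω then 1 else 0).choose r : ℝ≥0∞) ∂P) := by
  have := h.isProbabilityMeasure
  have h1 := h.lintegral_busySeen_valuation hp (n + 1) (f := fun k _ => (k.choose r : ℝ≥0∞))
    fun _ => measurable_const
  have h2 := h.lintegral_busySeen_valuation hp n
    (f := fun k x => ((k + if p k ≤ x then 1 else 0).choose r : ℝ≥0∞)) fun k => by
      have : Measurable fun x : ℝ≥0 => k + if p k ≤ (x : ℝ≥0∞) then 1 else 0 :=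
        measurable_const.add (Measurable.ite (measurableSet_le measurable_const
          measurable_coe_nnreal_ennreal) measurable_const measurable_const)
      exact (Measurable.of_discrete (f := fun k : ℕ => (k.choose r : ℝ≥0∞))).comp this
  simp only [lintegral_const, measure_univ, mul_one] at h1
  rw [← h1, h.lintegral_choose_busySeen_succ, h2, Finset.mul_sum]
  exact Finset.sum_congr rfl fun k _ => by ring

/-! ### Cesàro convergence in finite dimension -/

/-- Bounded orbits of a linear map of a finite-dimensional space converge in the Cesàro sense. -/
theorem LinearMap.exists_tendsto_cesaro_of_bounded {E : Type*} [NormedAddCommGroup E]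
    [NormedSpace ℝ E] [FiniteDimensional ℝ E] (L : E →ₗ[ℝ] E) (x : E) (C : ℝ)
    (hx : ∀ n : ℕ, ‖(L ^ n) x‖ ≤ C) :
    ∃ a, Tendsto (fun N : ℕ => (N : ℝ)⁻¹ • ∑ n ∈ Finset.range N, (L ^ n) x) atTop (𝓝 a) := by
  -- Only the orbit of `x` is assumed bounded, so the ergodic decomposition is carried out on the
  -- invariant subspace of all vectors with bounded orbit.
  let W : Submodule ℝ E :=
    { carrier := {y | ∃ C : ℝ, ∀ n : ℕ, ‖(L ^ n) y‖ ≤ C}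
      zero_mem' := ⟨0, by simp⟩
      add_mem' := by
        rintro a b ⟨A, hA⟩ ⟨B, hB⟩
        exact ⟨A + B, fun n => by
          rw [map_add]; exact (norm_add_le _ _).trans (add_le_add (hA n) (hB n))⟩
      smul_mem' := by
        rintro c a ⟨A, hA⟩
        exact ⟨‖c‖ * A, fun n => by
          rw [map_smul, norm_smul]; exact mul_le_mul_of_nonneg_left (hA n) (norm_nonneg _)⟩ }
  have hW : ∀ y ∈ W, L y ∈ W := by
    rintro y ⟨A, hA⟩
    exact ⟨A, fun n => by rw [← Module.End.mul_apply, ← pow_succ]; exact hA (n + 1)⟩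
  let f : W →ₗ[ℝ] W := L.restrict hW - 1
  have hf : ∀ y : W, ((f y : W) : E) = L y - y := fun y => rfl
  have hlim : ∀ C : ℝ, Tendsto (fun N : ℕ => (N : ℝ)⁻¹ * C) atTop (𝓝 0) := fun C => by
    simpa using tendsto_inv_atTop_nhds_zero_nat.mul_const C
  have htel : ∀ (y : E) (N : ℕ), ∑ n ∈ Finset.range N, (L ^ n) (L y - y) = (L ^ N) y - y := by
    intro y N
    have := Finset.sum_range_sub (fun n => (L ^ n) y) N
    simp only [pow_zero, Module.End.one_apply] at this
    rw [← this]
    refine Finset.sum_congr rfl fun n _ => ?_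
    rw [map_sub, pow_succ, Module.End.mul_apply]
  have hzero : ∀ y ∈ W,
      Tendsto (fun N : ℕ => (N : ℝ)⁻¹ • ((L ^ N) y - y)) atTop (𝓝 0) := by
    rintro y ⟨A, hA⟩
    refine squeeze_zero_norm (fun N => ?_) (hlim (A + ‖y‖))
    rw [norm_smul, norm_inv, Real.norm_natCast]
    exact mul_le_mul_of_nonneg_left ((norm_sub_le _ _).trans (add_le_add_left (hA N) _))
      (by positivity)
  have hfix : ∀ z : E, L z = z → ∀ n : ℕ, (L ^ n) z = z := by
    intro z hz n
    induction n with
    | zero => simp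
    | succ n ih => rw [pow_succ, Module.End.mul_apply, hz, ih]
  have havg : ∀ z : E, L z = z → Tendsto (fun N : ℕ =>
      (N : ℝ)⁻¹ • ∑ n ∈ Finset.range N, (L ^ n) z) atTop (𝓝 z) := by
    intro z hz
    refine tendsto_const_nhds.congr' ?_
    filter_upwards [eventually_gt_atTop 0] with N hN
    have : (N : ℝ) ≠ 0 := by positivity
    simp only [hfix z hz, Finset.sum_const, Finset.card_range]
    rw [← Nat.cast_smul_eq_nsmul ℝ, smul_smul, inv_mul_cancel₀ this, one_smul]
  -- A vector both fixed and of the form `L y - y` is the limit of its own averages, which telescope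
  -- to 0. With rank-nullity, range and kernel of `L - 1` then span `W`.
  have hdisj : Disjoint (LinearMap.range f) (LinearMap.ker f) := by
    rw [Submodule.disjoint_def]
    rintro _ ⟨y, rfl⟩ hy
    have hy' : L (f y : W) = (f y : W) := by
      have := hf (f y)
      rw [LinearMap.mem_ker.1 hy] at this
      exact (sub_eq_zero.1 (by simpa using this.symm))
    have h1 := havg _ hy'
    have h2 := hzero y y.2
    simp only [← htel] at h2
    exact Subtype.ext (tendsto_nhds_unique h1 h2)
  have htop := Submodule.eq_top_of_disjoint _ _ (LinearMap.finrank_range_add_finrank_ker f).ge hdisj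
  have hxm : (⟨x, C, hx⟩ : W) ∈ LinearMap.range f ⊔ LinearMap.ker f := htop ▸ Submodule.mem_top
  obtain ⟨_, ⟨y, rfl⟩, z, hz, hsum⟩ := Submodule.mem_sup.1 hxm
  have hxe : x = (L y - y) + z := by
    rw [← hf]; exact (congrArg Subtype.val hsum).symm
  have hz' : L z = (z : E) := by
    have := hf z
    rw [LinearMap.mem_ker.1 hz] at this
    exact (sub_eq_zero.1 (by simpa using this.symm))
  refine ⟨z, ?_⟩
  have := (hzero y y.2).add (havg z hz')
  rw [zero_add] at this
  refine this.congr fun N => ?_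
  rw [← htel, ← smul_add, ← Finset.sum_add_distrib, hxe]
  simp only [map_add]

theorem Nat.det_choose_matrix (K : ℕ) :
    (Matrix.of fun r k : Fin (K + 1) => ((k : ℕ).choose r : ℝ)).det = 1 := by
  rw [Matrix.det_of_isUpperTriangular]
  · simp
  · intro i j hij
    have : (j : ℕ) < i := hij
    simp [Nat.choose_eq_zero_of_lt this]

/-- A bounded sequence of vectors whose binomial moments are linear functions of the preceding
vector converges in the Cesàro sense. -/
theorem exists_tendsto_cesaro_of_choose_moments {K : ℕ} (q : ℕ → Fin (K + 1) → ℝ)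
    (M : Fin (K + 1) → Fin (K + 1) → ℝ) (hq : ∀ n k, |q n k| ≤ 1)
    (hM : ∀ n (r : Fin (K + 1)),
      ∑ k, q (n + 1) k * ((k : ℕ).choose r : ℝ) = ∑ k, q n k * M r k) :
    ∃ a : Fin (K + 1) → ℝ, ∀ k,
      Tendsto (fun N : ℕ => (N : ℝ)⁻¹ * ∑ n ∈ Finset.range N, q n k) atTop (𝓝 (a k)) := by
  set B : Matrix (Fin (K + 1)) (Fin (K + 1)) ℝ :=
    Matrix.of fun r k => ((k : ℕ).choose r : ℝ) with hB
  have hdet : IsUnit B.det := by rw [hB, Nat.det_choose_matrix]; exact isUnit_one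
  -- `B` maps a vector to its binomial moments, so inverting it recovers the whole next vector.
  set L := Matrix.mulVecLin (B⁻¹ * Matrix.of M) with hL
  have hstep : ∀ n, q (n + 1) = L (q n) := by
    intro n
    have : B.mulVec (q (n + 1)) = (Matrix.of M).mulVec (q n) := by
      ext r
      simpa [Matrix.mulVec, dotProduct, hB, mul_comm] using hM n r
    rw [hL, Matrix.mulVecLin_apply, ← Matrix.mulVec_mulVec, ← this, Matrix.mulVec_mulVec,
      Matrix.nonsing_inv_mul _ hdet, Matrix.one_mulVec]
  have horb : ∀ n, (L ^ n) (q 0) = q n := by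
    intro n
    induction n with
    | zero => simp
    | succ n ih => rw [pow_succ', Module.End.mul_apply, ih, hstep]
  obtain ⟨a, ha⟩ := L.exists_tendsto_cesaro_of_bounded (q 0) 1 fun n => by
    rw [horb, pi_norm_le_iff_of_nonneg zero_le_one]
    exact fun k => hq n k
  refine ⟨a, fun k => ?_⟩
  have := (tendsto_pi_nhds.1 ha) k
  simpa [horb] using this

/-! ### Laplace transform near 0 -/

/-- This is `exp (-y) ≤ 1 / (1 + y)` at y = θx. The quotient on the left tends to x as θ → 0, which
prepares the use of Fatou's lemma. -/
theorem one_sub_expTail_ge (θ x : ℝ≥0) :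
    (θ : ℝ≥0∞) * ENNReal.ofReal (x / (1 + θ * x)) ≤ 1 - expTail θ x := by
  have hpos : (0 : ℝ) < 1 + θ * x := by positivity
  have hexp : Real.exp (-(θ * x)) ≤ (1 + θ * x : ℝ)⁻¹ := by
    rw [Real.exp_neg]
    exact inv_anti₀ hpos (by linarith [Real.add_one_le_exp ((θ : ℝ) * x)])
  rw [expTail, ← ENNReal.ofReal_one, ← ENNReal.ofReal_sub _ (Real.exp_pos _).le,
    ← ENNReal.ofReal_coe_nnreal, ← ENNReal.ofReal_mul θ.coe_nonneg]
  refine ENNReal.ofReal_le_ofReal ?_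
  have : (θ : ℝ) * (x / (1 + θ * x)) = 1 - (1 + θ * x : ℝ)⁻¹ := by field_simp; ring
  linarith

/-- Below the mean, the Laplace transform of a nonnegative variable is, near `0`, at most that of a
constant. -/
theorem exists_lintegral_expTail_le {Ω : Type*} [MeasurableSpace Ω] {P : Measure Ω}
    [IsProbabilityMeasure P] {X : Ω → ℝ≥0} (hX : Measurable X) {m : ℝ≥0}
    (hm : (m : ℝ≥0∞) < ∫⁻ ω, (X ω : ℝ≥0∞) ∂P) :
    ∃ θ : ℝ≥0, 0 < θ ∧ ∫⁻ ω, expTail θ (X ω) ∂P ≤ expTail θ m := by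
  let θ : ℕ → ℝ≥0 := fun n => 1 / ((n : ℝ≥0) + 1)
  have hθ0 : Tendsto (fun n => (θ n : ℝ)) atTop (𝓝 0) := by
    simpa [θ] using tendsto_one_div_add_atTop_nhds_zero_nat (𝕜 := ℝ)
  let g : ℕ → Ω → ℝ≥0∞ := fun n ω => ENNReal.ofReal (X ω / (1 + θ n * X ω))
  have hlim : ∀ ω, Tendsto (fun n => g n ω) atTop (𝓝 (X ω : ℝ≥0∞)) := by
    intro ω
    rw [← ENNReal.ofReal_coe_nnreal]
    refine ENNReal.tendsto_ofReal ?_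
    have : Tendsto (fun n => (X ω : ℝ) / (1 + θ n * X ω)) atTop
        (𝓝 ((X ω : ℝ) / (1 + 0 * X ω))) :=
      tendsto_const_nhds.div (tendsto_const_nhds.add (hθ0.mul_const _)) (by simp)
    simpa using this
  have hgm : ∀ n, Measurable (g n) := fun n => by
    have := hX.coe_nnreal_real
    exact (this.div (measurable_const.add (measurable_const.mul this))).ennreal_ofReal
  have hfatou : ∫⁻ ω, (X ω : ℝ≥0∞) ∂P ≤ liminf (fun n => ∫⁻ ω, g n ω ∂P) atTop := by
    refine le_trans (le_of_eq (lintegral_congr fun ω => ?_)) (lintegral_liminf_le hgm)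
    exact (hlim ω).liminf_eq.symm
  obtain ⟨n, hn⟩ := (eventually_lt_of_lt_liminf (hm.trans_le hfatou)).exists
  have hθ : 0 < θ n := by positivity
  refine ⟨θ n, hθ, ?_⟩
  have hmeas : Measurable fun ω => expTail (θ n) (X ω) := (measurable_expTail _).comp hX
  have hle1 : ∫⁻ ω, expTail (θ n) (X ω) ∂P ≤ 1 :=
    (lintegral_mono fun ω => expTail_le_one _ _).trans (by simp)
  have h1 : (θ n : ℝ≥0∞) * m ≤ 1 - ∫⁻ ω, expTail (θ n) (X ω) ∂P := by
    calc (θ n : ℝ≥0∞) * m ≤ θ n * ∫⁻ ω, g n ω ∂P := by gcongr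
      _ = ∫⁻ ω, θ n * g n ω ∂P := (lintegral_const_mul _ (hgm n)).symm
      _ ≤ ∫⁻ ω, (1 - expTail (θ n) (X ω)) ∂P :=
          lintegral_mono fun ω => one_sub_expTail_ge _ _
      _ = 1 - ∫⁻ ω, expTail (θ n) (X ω) ∂P := by
          rw [lintegral_sub hmeas (ne_top_of_le_ne_top ENNReal.one_ne_top hle1)
            (ae_of_all _ fun ω => expTail_le_one _ _)]
          simp
  -- It remains to compare with the exponential: `1 - θ m ≤ exp (-θ m)`.
  have h2 : ∫⁻ ω, expTail (θ n) (X ω) ∂P ≤ 1 - (θ n : ℝ≥0∞) * m :=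
    ENNReal.le_sub_of_add_le_left (by finiteness)
      ((add_le_add_left h1 _).trans (tsub_add_cancel_of_le hle1).le)
  refine h2.trans ?_
  rw [expTail, ← ENNReal.coe_mul, ← ENNReal.ofReal_coe_nnreal, ← ENNReal.ofReal_one,
    ← ENNReal.ofReal_sub _ (NNReal.coe_nonneg _)]
  refine ENNReal.ofReal_le_ofReal ?_
  push_cast
  linarith [Real.add_one_le_exp (-((θ n : ℝ) * m))]

/-! ### Expected number of arrivals: Chernoff bound and Wald's inequality -/

section Renewal

variable {Ω : Type*} [MeasurableSpace Ω] {P : Measure Ω} {U V S : ℕ → Ω → ℝ≥0} {lam mu : ℝ≥0}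

theorem IsServiceModel.measurable_arrivalTime (h : IsServiceModel P U V S lam mu) (n : ℕ) :
    Measurable fun ω => arrivalTime (fun i => U i ω) n :=
  (_root_.measurable_arrivalTime n).comp h.measurable_inputAt

theorem IsServiceModel.measurableSet_arrivalTime_le (h : IsServiceModel P U V S lam mu) (n : ℕ)
    (t : ℝ≥0) : MeasurableSet {ω | arrivalTime (fun i => U i ω) n ≤ t} :=
  h.measurable_arrivalTime n measurableSet_Iic

/-- The next interarrival time is independent of the arrival times so far. -/
theorem IsServiceModel.lintegral_arrivalTime_mul (h : IsServiceModel P U V S lam mu) (n : ℕ)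
    {F f : ℝ≥0 → ℝ≥0∞} (hF : Measurable F) (hf : Measurable f) :
    ∫⁻ ω, F (arrivalTime (fun i => U i ω) n) * f (U (n + 1) ω) ∂P
      = (∫⁻ ω, F (arrivalTime (fun i => U i ω) n) ∂P) * ∫⁻ ω, f (U 0 ω) ∂P := by
  refine (h.lintegral_mul_of_update_eq (.inl (n + 1))
    (F := fun x => F (arrivalTime (fun i => x (.inl i)) n))
    (hF.comp (_root_.measurable_arrivalTime n)) (fun x y => ?_) hf).trans ?_
  · congr 1
    exact arrivalTime_congr fun i hi => Function.update_of_ne (by simp; omega) _ _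
  · congr 1
    exact ((h.identDistrib_interarrival (n + 1)).comp hf).lintegral_eq

theorem IsServiceModel.lintegral_expTail_arrivalTime (h : IsServiceModel P U V S lam mu)
    (θ : ℝ≥0) (n : ℕ) :
    ∫⁻ ω, expTail θ (arrivalTime (fun i => U i ω) n) ∂P
      = (∫⁻ ω, expTail θ (U 0 ω) ∂P) ^ (n + 1) := by
  induction n with
  | zero => simp [arrivalTime]
  | succ n ih =>
    rw [pow_succ, ← ih, ← h.lintegral_arrivalTime_mul n (measurable_expTail θ)
      (measurable_expTail θ)]
    simp only [arrivalTime_succ, expTail_add]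

/-- Chernoff bound: Markov's inequality for `expTail θ` of the arrival time, which is at least
`expTail θ t` when the arrival is by time `t`. -/
theorem IsServiceModel.measure_arrivalTime_le_mul (h : IsServiceModel P U V S lam mu)
    (θ t : ℝ≥0) (n : ℕ) :
    expTail θ t * P {ω | arrivalTime (fun i => U i ω) n ≤ t}
      ≤ (∫⁻ ω, expTail θ (U 0 ω) ∂P) ^ (n + 1) := by
  rw [← h.lintegral_expTail_arrivalTime]
  refine le_trans ?_ (mul_meas_ge_le_lintegral
    ((measurable_expTail θ).comp (h.measurable_arrivalTime n)) (expTail θ t))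
  refine mul_le_mul_right (measure_mono fun ω hω => ?_) _
  refine ENNReal.ofReal_le_ofReal (Real.exp_le_exp.2 (neg_le_neg ?_))
  have : arrivalTime (fun i => U i ω) n ≤ t := hω
  gcongr

/-- The expected number of arrivals until time `t` that come after those of the first `a * t`
customers is bounded when `a` exceeds the arrival rate. -/
theorem IsServiceModel.exists_tsum_measure_arrivalTime_le (h : IsServiceModel P U V S lam mu)
    {a : ℝ≥0} (ha : lam < a) :
    ∃ C : ℝ≥0, ∀ t : ℝ≥0,
      ∑' j, P {ω | arrivalTime (fun i => U i ω) (j + ⌈a * t⌉₊) ≤ t} ≤ C := by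
  have := h.isProbabilityMeasure
  have ha0 : 0 < a := h.lam_pos.trans ha
  -- As `1 / a` is below the mean interarrival time, some θ makes the Laplace transform at most `exp
  -- (-θ / a)`. The first `⌈a * t⌉₊` factors then pay for `expTail θ t`, and a geometric series in
  -- `j` remains.
  have hm : ((a⁻¹ : ℝ≥0) : ℝ≥0∞) < ∫⁻ ω, (U 0 ω : ℝ≥0∞) ∂P := by
    rw [h.mean_interarrival, ENNReal.coe_inv ha0.ne', ENNReal.inv_lt_inv]
    exact_mod_cast ha
  obtain ⟨θ, hθ, hle⟩ := exists_lintegral_expTail_le (h.measurable_interarrival 0) hm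
  have hlt : expTail θ a⁻¹ < 1 := by
    rw [expTail, ENNReal.ofReal_lt_one, Real.exp_lt_one_iff]
    have : (0 : ℝ) < θ * (a⁻¹ : ℝ≥0) := by positivity
    linarith
  have hC : (1 - expTail θ a⁻¹)⁻¹ ≠ ∞ := by
    rw [ENNReal.inv_ne_top]
    exact (tsub_pos_of_lt hlt).ne'
  refine ⟨((1 - expTail θ a⁻¹)⁻¹).toNNReal, fun t => ?_⟩
  rw [ENNReal.coe_toNNReal hC, ← ENNReal.tsum_geometric]
  refine ENNReal.tsum_le_tsum fun j => ?_
  have hpow : ∀ k : ℕ, expTail θ a⁻¹ ^ k = expTail θ (k * a⁻¹) := by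
    intro k
    rw [expTail, expTail, ← ENNReal.ofReal_pow (Real.exp_pos _).le, ← Real.exp_nat_mul]
    congr 2; push_cast; ring
  have hposT : expTail θ t ≠ 0 := by
    rw [expTail, Ne, ENNReal.ofReal_eq_zero, not_le]; exact Real.exp_pos _
  have hfinT : expTail θ t ≠ ∞ := ENNReal.ofReal_ne_top
  rw [← ENNReal.mul_le_mul_iff_right hposT hfinT]
  refine (h.measure_arrivalTime_le_mul θ t _).trans ((pow_le_pow_left' hle _).trans ?_)
  rw [hpow, hpow, ← expTail_add]
  refine ENNReal.ofReal_le_ofReal (Real.exp_le_exp.2 (neg_le_neg ?_))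
  have ht : t ≤ (⌈a * t⌉₊ : ℝ≥0) * a⁻¹ := by
    rw [← div_eq_mul_inv, le_div_iff₀ ha0, mul_comm]; exact Nat.le_ceil _
  have : t + j * a⁻¹ ≤ ((j + ⌈a * t⌉₊ + 1 : ℕ) : ℝ≥0) * a⁻¹ := by
    push_cast
    calc t + j * a⁻¹ ≤ (⌈a * t⌉₊ : ℝ≥0) * a⁻¹ + j * a⁻¹ + 1 * a⁻¹ := by
          refine le_trans ?_ le_self_add; gcongr
      _ = _ := by ring
  gcongr

/-- The expected number of arrivals until time `t` in excess of the first `lam * t` customers. -/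
noncomputable def expectedExcess (P : Measure Ω) (U : ℕ → Ω → ℝ≥0) (lam t : ℝ≥0) : ℝ≥0∞ :=
  ∑' j, P {ω | arrivalTime (fun i => U i ω) (j + ⌈lam * t⌉₊) ≤ t}

theorem ENNReal.tsum_nat_add_le {b : ℕ → ℝ≥0∞} (hb : ∀ n, b n ≤ 1) (M d : ℕ) :
    ∑' j, b (j + M) ≤ d + ∑' j, b (j + (M + d)) := by
  rw [← Summable.sum_add_tsum_nat_add' (f := fun j => b (j + M)) (k := d)]
  · refine add_le_add ?_ (le_of_eq (tsum_congr fun j => by congr 1; ring))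
    refine (Finset.sum_le_card_nsmul _ _ 1 fun j _ => hb _).trans ?_
    simp
  · exact ENNReal.summable

theorem IsServiceModel.tendsto_expectedExcess_div (h : IsServiceModel P U V S lam mu) :
    Tendsto (fun t : ℝ≥0 => expectedExcess P U lam t / t) atTop (𝓝 0) := by
  have := h.isProbabilityMeasure
  rw [ENNReal.tendsto_nhds_zero]
  intro ε hε
  obtain ⟨e, he0, he⟩ := ENNReal.lt_iff_exists_nnreal_btwn.1 hε
  have he0' : 0 < e := by exact_mod_cast he0
  -- Half of the allowance `e * t` covers the customers between `lam * t` and `(lam + e / 2) * t`,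
  -- up to rounding. The other half covers the constant `1 + C` once `t` is large.
  obtain ⟨C, hC⟩ := h.exists_tsum_measure_arrivalTime_le (a := lam + e / 2)
    (lt_add_of_pos_right _ (by positivity))
  filter_upwards [eventually_ge_atTop ((1 + C) / (e / 2)), eventually_gt_atTop 0] with t ht ht0
  refine le_trans ?_ he.le
  rw [ENNReal.div_le_iff (by exact_mod_cast ht0.ne') ENNReal.coe_ne_top]
  have hmono : ⌈lam * t⌉₊ ≤ ⌈(lam + e / 2) * t⌉₊ := by gcongr; exact le_self_add
  obtain ⟨d, hd⟩ := Nat.exists_eq_add_of_le hmono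
  have hdle : (d : ℝ≥0) ≤ e / 2 * t + 1 := by
    have h1 : (⌈(lam + e / 2) * t⌉₊ : ℝ≥0) < (lam + e / 2) * t + 1 := Nat.ceil_lt_add_one zero_le
    have h2 : lam * t ≤ (⌈lam * t⌉₊ : ℝ≥0) := Nat.le_ceil _
    rw [hd] at h1
    push_cast at h1
    rw [← NNReal.coe_le_coe]
    rw [← NNReal.coe_lt_coe] at h1
    rw [← NNReal.coe_le_coe] at h2
    push_cast at h1 h2 ⊢
    linarith
  calc expectedExcess P U lam t
      ≤ d + ∑' j, P {ω | arrivalTime (fun i => U i ω) (j + (⌈lam * t⌉₊ + d)) ≤ t} :=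
        ENNReal.tsum_nat_add_le
          (b := fun j => P {ω | arrivalTime (fun i => U i ω) j ≤ t}) (fun _ => prob_le_one) _ _
    _ ≤ d + C := by rw [← hd]; gcongr; exact hC t
    _ ≤ (e : ℝ≥0∞) * t := by
        have h3 : 1 + C ≤ e / 2 * t := by
          rw [div_le_iff₀ (by positivity)] at ht; rwa [mul_comm]
        have : (d : ℝ≥0) + C ≤ e * t := by
          calc (d : ℝ≥0) + C ≤ e / 2 * t + 1 + C := by gcongr
            _ = e / 2 * t + (1 + C) := by ring
            _ ≤ e / 2 * t + e / 2 * t := by gcongr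
            _ = e * t := by rw [← add_mul, add_halves]
        exact_mod_cast this

/-- The increments that follow arrivals by time `t` lead to the first arrival after `t`. Truncating
at a fixed index `k` replaces the stopping time in Wald's identity by a finite sum. -/
theorem min_arrivalTime_le (u : ℕ → ℝ≥0) (t : ℝ≥0) (k : ℕ) :
    min t (arrivalTime u k)
      ≤ u 0 + ∑ n ∈ Finset.range k, if arrivalTime u n ≤ t then u (n + 1) else 0 := by
  induction k with
  | zero => simp [arrivalTime]
  | succ k ih =>
    rw [Finset.sum_range_succ, ← add_assoc]
    split_ifs with hk
    · rw [min_eq_right hk] at ih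
      exact (min_le_right _ _).trans (by rw [arrivalTime_succ]; gcongr)
    · rw [min_eq_left (le_of_not_ge hk)] at ih
      exact (min_le_left _ _).trans (by simpa using ih)

/-- Wald's inequality: on average at least `lam * t - 1` customers arrive until time `t`. -/
theorem IsServiceModel.mul_le_one_add_tsum (h : IsServiceModel P U V S lam mu) (t : ℝ≥0)
    (hfin : ∑' n, P {ω | arrivalTime (fun i => U i ω) n ≤ t} ≠ ∞) :
    (lam : ℝ≥0∞) * t ≤ 1 + ∑' n, P {ω | arrivalTime (fun i => U i ω) n ≤ t} := by
  have := h.isProbabilityMeasure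
  set N := ∑' n, P {ω | arrivalTime (fun i => U i ω) n ≤ t} with hN
  have hlam : (lam : ℝ≥0∞) ≠ 0 := by exact_mod_cast h.lam_pos.ne'
  have hone : ∀ n, ∫⁻ ω, (if arrivalTime (fun i => U i ω) n ≤ t then (1 : ℝ≥0∞) else 0) ∂P
      = P {ω | arrivalTime (fun i => U i ω) n ≤ t} := fun n => by
    rw [← lintegral_indicator_one (h.measurableSet_arrivalTime_le n t)]
    exact lintegral_congr fun ω => by simp [Set.indicator]
  have hmI : Measurable fun x : ℝ≥0 => if x ≤ t then (1 : ℝ≥0∞) else 0 :=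
    Measurable.ite measurableSet_Iic measurable_const measurable_const
  have hterm : ∀ n, ∫⁻ ω, (if arrivalTime (fun i => U i ω) n ≤ t then (1 : ℝ≥0∞) else 0)
      * U (n + 1) ω ∂P = P {ω | arrivalTime (fun i => U i ω) n ≤ t} * (lam : ℝ≥0∞)⁻¹ := fun n => by
    rw [h.lintegral_arrivalTime_mul n hmI measurable_coe_nnreal_ennreal, hone, h.mean_interarrival]
  have hmin : ∀ k, ∫⁻ ω, ((min t (arrivalTime (fun i => U i ω) k) : ℝ≥0) : ℝ≥0∞) ∂P
      ≤ (lam : ℝ≥0∞)⁻¹ * (1 + N) := by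
    intro k
    calc ∫⁻ ω, ((min t (arrivalTime (fun i => U i ω) k) : ℝ≥0) : ℝ≥0∞) ∂P
        ≤ ∫⁻ ω, ((U 0 ω : ℝ≥0∞) + ∑ n ∈ Finset.range k,
            (if arrivalTime (fun i => U i ω) n ≤ t then (1 : ℝ≥0∞) else 0) * U (n + 1) ω) ∂P := by
          refine lintegral_mono fun ω => ?_
          refine (ENNReal.coe_le_coe.2 (min_arrivalTime_le (fun i => U i ω) t k)).trans ?_
          push_cast
          refine add_le_add le_rfl (Finset.sum_le_sum fun n _ => ?_)
          split_ifs <;> simp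
      _ = (lam : ℝ≥0∞)⁻¹ + ∑ n ∈ Finset.range k,
            P {ω | arrivalTime (fun i => U i ω) n ≤ t} * (lam : ℝ≥0∞)⁻¹ := by
          rw [lintegral_add_left (h.measurable_interarrival 0).coe_nnreal_ennreal,
            h.mean_interarrival]
          congr 1
          refine (lintegral_finsetSum _ fun n _ => (hmI.comp (h.measurable_arrivalTime n)).mul
            (h.measurable_interarrival (n + 1)).coe_nnreal_ennreal).trans ?_
          exact Finset.sum_congr rfl fun n _ => hterm n
      _ ≤ (lam : ℝ≥0∞)⁻¹ * (1 + N) := by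
          rw [← Finset.sum_mul, mul_add, mul_one, mul_comm (lam : ℝ≥0∞)⁻¹ N]
          gcongr
          exact ENNReal.sum_le_tsum _
  -- The truncated minimum equals `t` unless arrival `k` comes by time `t`. The probability of the
  -- latter tends to 0, being summable in `k`.
  have hlow : ∀ k, (t : ℝ≥0∞) * (1 - P {ω | arrivalTime (fun i => U i ω) k ≤ t})
      ≤ (lam : ℝ≥0∞)⁻¹ * (1 + N) := by
    intro k
    refine le_trans ?_ (hmin k)
    rw [← prob_compl_eq_one_sub (h.measurableSet_arrivalTime_le k t)]
    refine le_trans ?_ (mul_meas_ge_le_lintegral (measurable_const.min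
      (h.measurable_arrivalTime k)).coe_nnreal_ennreal (t : ℝ≥0∞))
    refine mul_le_mul_right (measure_mono fun ω hω => ?_) _
    have : t < arrivalTime (fun i => U i ω) k := not_le.1 hω
    simp [this.le]
  have hlim : Tendsto (fun k => (t : ℝ≥0∞) * (1 - P {ω | arrivalTime (fun i => U i ω) k ≤ t}))
      atTop (𝓝 (t * (1 - 0))) :=
    ENNReal.Tendsto.const_mul (ENNReal.Tendsto.sub tendsto_const_nhds
      (ENNReal.tendsto_atTop_zero_of_tsum_ne_top hfin) (.inl ENNReal.one_ne_top))
      (.inr ENNReal.coe_ne_top)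
  have := le_of_tendsto' hlim hlow
  rw [tsub_zero, mul_one] at this
  calc (lam : ℝ≥0∞) * t ≤ lam * ((lam : ℝ≥0∞)⁻¹ * (1 + N)) := by gcongr
    _ = 1 + N := by rw [← mul_assoc, ENNReal.mul_inv_cancel hlam ENNReal.coe_ne_top, one_mul]

end Renewal

theorem tendsto_natCeil_mul_div_ennreal (a : ℝ≥0) :
    Tendsto (fun t : ℝ≥0 => (⌈a * t⌉₊ : ℝ≥0∞) / t) atTop (𝓝 a) := by
  have h1 : Tendsto (fun t : ℝ≥0 => (⌈a * t⌉₊ : ℝ≥0) / t) atTop (𝓝 a) := by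
    rw [← NNReal.tendsto_coe]
    have := (tendsto_nat_ceil_mul_div_atTop a.coe_nonneg).comp
      (NNReal.tendsto_coe_atTop.2 (tendsto_id (α := ℝ≥0) (x := atTop)))
    exact this.congr fun t => rfl
  refine (ENNReal.tendsto_coe.2 h1).congr' ?_
  filter_upwards [eventually_gt_atTop 0] with t ht
  rw [ENNReal.coe_div ht.ne']
  simp

/-! ### From averages over customers to averages over time -/

section RenewalReward

variable {Ω : Type*} [MeasurableSpace Ω] {P : Measure Ω} {U V S : ℕ → Ω → ℝ≥0} {lam mu : ℝ≥0}

theorem ENNReal.tsum_eq_sum_add_tsum_nat_add (b : ℕ → ℝ≥0∞) (M : ℕ) :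
    ∑' n, b n = ∑ n ∈ Finset.range M, b n + ∑' j, b (j + M) :=
  (Summable.sum_add_tsum_nat_add' (f := b) (k := M) ENNReal.summable).symm

theorem IsServiceModel.tsum_measure_arrivalTime_le_ne_top (h : IsServiceModel P U V S lam mu)
    (t : ℝ≥0) :
    ∑' n, P {ω | arrivalTime (fun i => U i ω) n ≤ t} ≠ ∞ := by
  have := h.isProbabilityMeasure
  obtain ⟨C, hC⟩ := h.exists_tsum_measure_arrivalTime_le (a := lam + 1) (by simp)
  rw [ENNReal.tsum_eq_sum_add_tsum_nat_add _ ⌈(lam + 1) * t⌉₊]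
  refine ENNReal.add_ne_top.2 ⟨ENNReal.sum_ne_top.2 fun n _ => measure_ne_top _ _, ?_⟩
  exact ne_top_of_le_ne_top ENNReal.coe_ne_top (hC t)

/-- The expected number of the first `lam * t` customers that arrive after time `t`. -/
theorem IsServiceModel.sum_measure_lt_arrivalTime_le (h : IsServiceModel P U V S lam mu)
    (t : ℝ≥0) :
    ∑ n ∈ Finset.range ⌈lam * t⌉₊, P {ω | t < arrivalTime (fun i => U i ω) n}
      ≤ expectedExcess P U lam t + 2 := by
  have := h.isProbabilityMeasure
  have hfin := h.tsum_measure_arrivalTime_le_ne_top t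
  have hwald := h.mul_le_one_add_tsum t hfin
  rw [ENNReal.tsum_eq_sum_add_tsum_nat_add _ ⌈lam * t⌉₊] at hwald hfin
  set early := ∑ n ∈ Finset.range ⌈lam * t⌉₊, P {ω | arrivalTime (fun i => U i ω) n ≤ t}
  have hadd : early + ∑ n ∈ Finset.range ⌈lam * t⌉₊, P {ω | t < arrivalTime (fun i => U i ω) n}
      = ⌈lam * t⌉₊ := by
    rw [← Finset.sum_add_distrib, Finset.sum_congr rfl (g := fun _ => (1 : ℝ≥0∞))]
    · simp
    · intro n _
      have hc : {ω | t < arrivalTime (fun i => U i ω) n}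
          = {ω | arrivalTime (fun i => U i ω) n ≤ t}ᶜ := by
        ext ω; simp
      rw [hc, prob_add_prob_compl (h.measurableSet_arrivalTime_le n t)]
  have hceil : (⌈lam * t⌉₊ : ℝ≥0∞) ≤ lam * t + 1 := by
    have : (⌈lam * t⌉₊ : ℝ≥0) ≤ lam * t + 1 := (Nat.ceil_lt_add_one zero_le).le
    exact_mod_cast this
  have hfin' : early ≠ ∞ := (ENNReal.add_ne_top.1 hfin).1
  -- Early and late customers add up to `⌈lam * t⌉₊`. Of the constant 2, one unit comes from Wald's
  -- inequality and one from the rounding.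
  refine (ENNReal.add_le_add_iff_left hfin').1 ?_
  rw [hadd]
  calc (⌈lam * t⌉₊ : ℝ≥0∞) ≤ lam * t + 1 := hceil
    _ ≤ 1 + (early + expectedExcess P U lam t) + 1 := by gcongr; exact hwald
    _ = early + (expectedExcess P U lam t + 2) := by rw [← one_add_one_eq_two]; ring

/-- Rewards that are bounded and whose expectations converge in the Cesàro sense accumulate at the
limiting expectation times the arrival rate. -/
theorem IsServiceModel.tendsto_lintegral_tsum_div (h : IsServiceModel P U V S lam mu)
    {π : ℕ → Ω → ℝ≥0∞} (hπ : ∀ n, Measurable (π n)) {C : ℝ≥0} (hC : ∀ n ω, π n ω ≤ C) {ρ : ℝ≥0∞}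
    (hρ : Tendsto (fun N : ℕ => (∑ n ∈ Finset.range N, ∫⁻ ω, π n ω ∂P) / N) atTop (𝓝 ρ)) :
    Tendsto (fun t : ℝ≥0 => (∫⁻ ω, ∑' n,
      (if arrivalTime (fun i => U i ω) n ≤ t then π n ω else 0) ∂P) / t) atTop (𝓝 (lam * ρ)) := by
  have := h.isProbabilityMeasure
  set A : ℕ → Ω → ℝ≥0 := fun n ω => arrivalTime (fun i => U i ω) n with hA
  have hset : ∀ n t, MeasurableSet {ω | A n ω ≤ t} := h.measurableSet_arrivalTime_le
  have hset' : ∀ n t, MeasurableSet {ω | t < A n ω} := fun n t =>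
    h.measurable_arrivalTime n measurableSet_Ioi
  have hlt1 : ∀ n t, ∫⁻ ω, (if A n ω ≤ t then π n ω else 0) ∂P ≤ C * P {ω | A n ω ≤ t} := by
    intro n t
    rw [← lintegral_indicator_const (hset n t)]
    refine lintegral_mono fun ω => ?_
    by_cases hω : A n ω ≤ t <;> simp [hω, hC]
  have hlt2 : ∀ n t, ∫⁻ ω, π n ω ∂P
      ≤ ∫⁻ ω, (if A n ω ≤ t then π n ω else 0) ∂P + C * P {ω | t < A n ω} := by
    intro n t
    rw [← lintegral_indicator_const (hset' n t), ← lintegral_add_left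
      (Measurable.ite (hset n t) (hπ n) measurable_const)]
    refine lintegral_mono fun ω => ?_
    by_cases hω : A n ω ≤ t
    · simp [hω]
    · simp [hω, not_le.1 hω, hC]
  set R : ℝ≥0 → ℝ≥0∞ := fun t => ∫⁻ ω, ∑' n, (if A n ω ≤ t then π n ω else 0) ∂P with hR
  set T : ℝ≥0 → ℝ≥0∞ := fun t => ∑ n ∈ Finset.range ⌈lam * t⌉₊, ∫⁻ ω, π n ω ∂P with hT
  have hRsum : ∀ t, R t = ∑' n, ∫⁻ ω, (if A n ω ≤ t then π n ω else 0) ∂P := fun t =>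
    lintegral_tsum fun n => (Measurable.ite (hset n t) (hπ n) measurable_const).aemeasurable
  -- Rewards may depend on the arrival times, so no factorization is attempted: each customer on
  -- which `R` and `T` disagree costs at most `C`.
  have hup : ∀ t, R t ≤ T t + C * expectedExcess P U lam t := by
    intro t
    rw [hRsum, ENNReal.tsum_eq_sum_add_tsum_nat_add _ ⌈lam * t⌉₊, expectedExcess,
      ← ENNReal.tsum_mul_left]
    refine add_le_add (Finset.sum_le_sum fun n _ => lintegral_mono fun ω => ?_)
      (ENNReal.tsum_le_tsum fun j => hlt1 _ t)
    split_ifs <;> simp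
  have hlow : ∀ t, T t ≤ R t + C * (expectedExcess P U lam t + 2) := by
    intro t
    calc T t ≤ ∑ n ∈ Finset.range ⌈lam * t⌉₊, (∫⁻ ω, (if A n ω ≤ t then π n ω else 0) ∂P
          + C * P {ω | t < A n ω}) := Finset.sum_le_sum fun n _ => hlt2 n t
      _ ≤ R t + C * (expectedExcess P U lam t + 2) := by
          rw [Finset.sum_add_distrib, ← Finset.mul_sum, hRsum]
          gcongr
          · exact ENNReal.sum_le_tsum _
          · exact h.sum_measure_lt_arrivalTime_le t
  have hexc := h.tendsto_expectedExcess_div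
  have htwo : Tendsto (fun t : ℝ≥0 => (2 : ℝ≥0∞) / t) atTop (𝓝 0) := by
    have : Tendsto (fun t : ℝ≥0 => (t : ℝ≥0∞)) atTop (𝓝 ∞) :=
      ENNReal.tendsto_coe_nhds_top.2 tendsto_id
    simpa using ENNReal.Tendsto.const_div this (.inr (by simp : (2 : ℝ≥0∞) ≠ ∞))
  have herr1 : Tendsto (fun t : ℝ≥0 => C * (expectedExcess P U lam t / t)) atTop (𝓝 0) := by
    simpa using ENNReal.Tendsto.const_mul hexc (.inr (ENNReal.coe_ne_top (r := C)))
  have herr2 : Tendsto (fun t : ℝ≥0 => C * (expectedExcess P U lam t / t + 2 / t)) atTop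
      (𝓝 0) := by
    simpa using ENNReal.Tendsto.const_mul (hexc.add htwo) (.inr (ENNReal.coe_ne_top (r := C)))
  have hρC : ρ ≤ C := by
    refine le_of_tendsto' hρ fun N => ENNReal.div_le_of_le_mul ?_
    refine (Finset.sum_le_card_nsmul _ _ (C : ℝ≥0∞) fun n _ => ?_).trans (by simp [mul_comm])
    exact (lintegral_mono (hC n)).trans (by simp)
  have hρtop : ρ ≠ ∞ := ne_top_of_le_ne_top ENNReal.coe_ne_top hρC
  have hMtop : Tendsto (fun t : ℝ≥0 => ⌈lam * t⌉₊) atTop atTop :=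
    tendsto_nat_ceil_atTop.comp (Tendsto.const_mul_atTop h.lam_pos tendsto_id)
  have hTlim : Tendsto (fun t : ℝ≥0 => T t / t) atTop (𝓝 (lam * ρ)) := by
    have := ENNReal.Tendsto.mul (tendsto_natCeil_mul_div_ennreal lam) (.inr hρtop)
      (hρ.comp hMtop) (.inr ENNReal.coe_ne_top)
    refine this.congr' ?_
    filter_upwards [eventually_gt_atTop 0] with t ht
    have hM : (⌈lam * t⌉₊ : ℝ≥0∞) ≠ 0 := by
      simpa using ⟨h.lam_pos.ne', ht.ne'⟩
    simp only [Function.comp_apply, hT]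
    rw [div_eq_mul_inv, div_eq_mul_inv, div_eq_mul_inv, mul_right_comm, mul_comm _ (_ * _⁻¹),
      mul_assoc (∑ n ∈ Finset.range ⌈lam * t⌉₊, ∫⁻ ω, π n ω ∂P), mul_comm _⁻¹ (⌈lam * t⌉₊ : ℝ≥0∞),
      ENNReal.mul_inv_cancel hM (ENNReal.natCast_ne_top _), mul_one]
  refine tendsto_of_tendsto_of_tendsto_of_le_of_le
    (g := fun t : ℝ≥0 => T t / t - C * (expectedExcess P U lam t / t + 2 / t))
    (h := fun t : ℝ≥0 => T t / t + C * (expectedExcess P U lam t / t)) ?_ ?_ ?_ ?_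
  · simpa using ENNReal.Tendsto.sub hTlim herr2 (.inr ENNReal.zero_ne_top)
  · simpa using hTlim.add herr1
  · intro t
    dsimp only
    rw [tsub_le_iff_right, ← ENNReal.add_div, ← mul_div_assoc, ← ENNReal.add_div]
    exact ENNReal.div_le_div_right (hlow t) _
  · intro t
    dsimp only
    rw [← mul_div_assoc, ← ENNReal.add_div]
    exact ENNReal.div_le_div_right (hup t) _

end RenewalReward

/-! ### The revenue curve of a single customer -/

section Valuation

variable {Ω : Type*} [MeasurableSpace Ω] {P : Measure Ω} {U V S : ℕ → Ω → ℝ≥0} {lam mu : ℝ≥0}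

/-- Continuity of the distribution function excludes atoms at positive points, positivity of the
valuation an atom at 0. This reconciles joining when the valuation is at least the price with a tail
defined by strict inequality. -/
theorem IsServiceModel.measure_valuation_lt (h : IsServiceModel P U V S lam mu) (x : ℝ≥0) :
    P {ω | V 0 ω < x} = P {ω | V 0 ω ≤ x} := by
  refine le_antisymm (measure_mono fun ω (hω : V 0 ω < x) => hω.le) ?_
  rcases eq_or_ne x 0 with rfl | hx
  · have : P {ω | V 0 ω ≤ 0} = 0 := by
      have := h.valuation_pos
      rw [ae_iff] at this
      simpa using this
    rw [this]
    exact zero_le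
  · have : (𝓝[<] x).NeBot := nhdsLT_neBot_of_exists_lt ⟨0, pos_iff_ne_zero.2 hx⟩
    refine le_of_tendsto (h.continuous_valuation.continuousAt.tendsto.mono_left
      (nhdsWithin_le_nhds (s := Set.Iio x))) ?_
    filter_upwards [self_mem_nhdsWithin] with y hy
    exact measure_mono fun ω (hω : V 0 ω ≤ y) => hω.trans_lt hy

theorem IsServiceModel.measure_le_valuation (h : IsServiceModel P U V S lam mu) (x : ℝ≥0) :
    P {ω | x ≤ V 0 ω} = tailProb P (V 0) x := by
  have := h.isProbabilityMeasure
  rw [tailProb, ← h.measure_valuation_lt, ← prob_compl_eq_one_sub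
    (measurableSet_lt (h.measurable_valuation 0) measurable_const)]
  congr 1
  ext ω
  simp

theorem tailProb_le_one (W : Ω → ℝ≥0) (x : ℝ≥0) : tailProb P W x ≤ 1 := tsub_le_self

theorem mul_tailProb_ne_top (W : Ω → ℝ≥0) (x : ℝ≥0) : (x : ℝ≥0∞) * tailProb P W x ≠ ∞ :=
  ENNReal.mul_ne_top ENNReal.coe_ne_top
    (ne_top_of_le_ne_top ENNReal.one_ne_top (tailProb_le_one W x))

theorem IsServiceModel.continuous_mul_tailProb (h : IsServiceModel P U V S lam mu) :
    Continuous fun x : ℝ≥0 => (x : ℝ≥0∞) * tailProb P (V 0) x := by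
  refine continuous_iff_continuousAt.2 fun x => ENNReal.Tendsto.mul
    ENNReal.continuous_coe.continuousAt
    (.inr (ne_top_of_le_ne_top ENNReal.one_ne_top (tailProb_le_one _ _))) ?_
    (.inr ENNReal.coe_ne_top)
  exact ENNReal.Tendsto.sub tendsto_const_nhds h.continuous_valuation.continuousAt
    (.inl ENNReal.one_ne_top)

/-- On the event V ≥ x one has x ≤ V, so the product is at most the mean of V over that event, which
vanishes by dominated convergence because V is integrable. -/
theorem IsServiceModel.tendsto_mul_tailProb (h : IsServiceModel P U V S lam mu) :
    Tendsto (fun x : ℝ≥0 => (x : ℝ≥0∞) * tailProb P (V 0) x) atTop (𝓝 0) := by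
  have hset : ∀ x : ℝ≥0, MeasurableSet {ω | x ≤ V 0 ω} := fun x =>
    measurableSet_le measurable_const (h.measurable_valuation 0)
  have hVm := (h.measurable_valuation 0).coe_nnreal_ennreal
  have hdom : Tendsto (fun x : ℝ≥0 => ∫⁻ ω,
      {ω | x ≤ V 0 ω}.indicator (fun ω => (V 0 ω : ℝ≥0∞)) ω ∂P) atTop
      (𝓝 (∫⁻ _, 0 ∂P)) := by
    refine tendsto_lintegral_filter_of_dominated_convergence (fun ω => (V 0 ω : ℝ≥0∞))
      (.of_forall fun x => hVm.indicator (hset x))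
      (.of_forall fun x => ae_of_all _ fun ω => Set.indicator_le_self _ _ _) h.mean_valuation
      (ae_of_all _ fun ω => tendsto_const_nhds.congr' ?_)
    filter_upwards [eventually_gt_atTop (V 0 ω)] with x hx
    simp [not_le.2 hx]
  rw [lintegral_zero] at hdom
  refine tendsto_of_tendsto_of_tendsto_of_le_of_le tendsto_const_nhds hdom
    (fun _ => zero_le) fun x => ?_
  dsimp only
  rw [← h.measure_le_valuation, ← lintegral_indicator_const (hset x)]
  refine lintegral_mono fun ω => Set.indicator_le_indicator' fun hω => ?_
  exact ENNReal.coe_le_coe.2 hω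

/-- An optimal uniform price exists. -/
theorem IsServiceModel.exists_forall_mul_tailProb_le (h : IsServiceModel P U V S lam mu) :
    ∃ pInf : ℝ≥0,
      ∀ x : ℝ≥0, (x : ℝ≥0∞) * tailProb P (V 0) x ≤ pInf * tailProb P (V 0) pInf := by
  by_cases hzero : ∀ x : ℝ≥0, (x : ℝ≥0∞) * tailProb P (V 0) x = 0
  · exact ⟨0, fun x => by rw [hzero, hzero]⟩
  · push Not at hzero
    obtain ⟨x₀, hx₀⟩ := hzero
    refine h.continuous_mul_tailProb.exists_forall_ge' x₀ ?_
    rw [cocompact_eq_atTop]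
    exact (h.tendsto_mul_tailProb.eventually (gt_mem_nhds (pos_iff_ne_zero.2 hx₀))).mono
      fun x hx => hx.le

/-- The payment at the price `p k` of a customer with valuation `x`. -/
noncomputable def payAt (p : ℕ → ℝ≥0∞) (k : ℕ) (x : ℝ≥0) : ℝ≥0∞ :=
  if p k ≤ x then p k else 0

theorem measurable_payAt (p : ℕ → ℝ≥0∞) (k : ℕ) : Measurable (payAt p k) :=
  Measurable.ite (measurableSet_le measurable_const measurable_coe_nnreal_ennreal)
    measurable_const measurable_const

theorem IsServiceModel.lintegral_payAt_coe (h : IsServiceModel P U V S lam mu) {p : ℕ → ℝ≥0∞}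
    {k : ℕ} {x : ℝ≥0} (hx : p k = x) :
    ∫⁻ ω, payAt p k (V 0 ω) ∂P = x * tailProb P (V 0) x := by
  rw [← h.measure_le_valuation, ← lintegral_indicator_const
    (measurableSet_le measurable_const (h.measurable_valuation 0))]
  exact lintegral_congr fun ω => by simp [payAt, hx, Set.indicator]

theorem payAt_top {p : ℕ → ℝ≥0∞} {k : ℕ} (hk : p k = ∞) (x : ℝ≥0) : payAt p k x = 0 := by
  simp [payAt, hk]

theorem IsServiceModel.lintegral_payAt_le (h : IsServiceModel P U V S lam mu) {pInf : ℝ≥0}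
    (hp : ∀ x : ℝ≥0, (x : ℝ≥0∞) * tailProb P (V 0) x ≤ pInf * tailProb P (V 0) pInf)
    (p : ℕ → ℝ≥0∞) (k : ℕ) :
    ∫⁻ ω, payAt p k (V 0 ω) ∂P ≤ pInf * tailProb P (V 0) pInf := by
  cases hk : p k with
  | top => simp [payAt_top hk]
  | coe x => rw [h.lintegral_payAt_coe hk]; exact hp x

theorem lintegral_payAt_ne_top [IsProbabilityMeasure P] (p : ℕ → ℝ≥0∞) (k : ℕ) :
    ∫⁻ ω, payAt p k (V 0 ω) ∂P ≠ ∞ := by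
  cases hk : p k with
  | top => simp [payAt_top hk]
  | coe x =>
    refine ne_top_of_le_ne_top (b := (x : ℝ≥0∞)) ENNReal.coe_ne_top
      ((lintegral_mono (g := fun _ => (x : ℝ≥0∞)) fun ω => ?_).trans (by simp))
    unfold payAt
    split_ifs <;> simp [hk]

theorem IsServiceModel.measurable_payAt_seen (h : IsServiceModel P U V S lam mu)
    (p : ℕ → ℝ≥0∞) (n : ℕ) :
    Measurable fun ω => payAt p (seen p (inputAt U V S ω) n) (V n ω) := by
  have h1 : Measurable fun ω => p (seen p (inputAt U V S ω) n) :=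
    (Measurable.of_discrete (f := p)).comp ((measurable_seen p n).comp h.measurable_inputAt)
  exact Measurable.ite (measurableSet_le h1 (h.measurable_valuation n).coe_nnreal_ennreal) h1
    measurable_const

end Valuation

/-! ### The upper bound and the existence of revenue rates -/

section Revenue

variable {Ω : Type*} [MeasurableSpace Ω] {P : Measure Ω} {U V S : ℕ → Ω → ℝ≥0} {lam mu : ℝ≥0}

theorem averageRevenue_eq (p : ℕ → ℝ≥0∞) (t : ℝ≥0) :
    averageRevenue P U V S p t = (∫⁻ ω, ∑' n, (if arrivalTime (fun i => U i ω) n ≤ t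
      then payAt p (seen p (inputAt U V S ω) n) (V n ω) else 0) ∂P) / t := rfl

/-- The arrival indicator `W` does not involve the valuation of customer `n`. Splitting over the
state `k` found, each price `p k` earns on average at most the maximum; prices need not be bounded.
-/
theorem IsServiceModel.lintegral_payment_le (h : IsServiceModel P U V S lam mu) {pInf : ℝ≥0}
    (hp : ∀ x : ℝ≥0, (x : ℝ≥0∞) * tailProb P (V 0) x ≤ pInf * tailProb P (V 0) pInf)
    (p : ℕ → ℝ≥0∞) (n : ℕ) (t : ℝ≥0) :
    ∫⁻ ω, (if arrivalTime (fun i => U i ω) n ≤ t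
      then payAt p (seen p (inputAt U V S ω) n) (V n ω) else 0) ∂P
      ≤ pInf * tailProb P (V 0) pInf
        * ∫⁻ ω, (if arrivalTime (fun i => U i ω) n ≤ t then 1 else 0) ∂P := by
  have := h.isProbabilityMeasure
  set r := (pInf : ℝ≥0∞) * tailProb P (V 0) pInf with hr
  let W : (ℕ ⊕ ℕ ⊕ ℕ → ℝ≥0) → ℝ≥0∞ := fun x =>
    if arrivalTime (fun i => x (.inl i)) n ≤ t then 1 else 0
  have hW : Measurable W := Measurable.ite (_root_.measurable_arrivalTime n measurableSet_Iic)
    measurable_const measurable_const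
  have hWn : ∀ x y, W (Function.update x (.inr (.inl n)) y) = W x := fun x y => by simp [W]
  have h1 := h.lintegral_mul_busySeen_valuation p n hW hWn (measurable_payAt p)
  have h2 := h.lintegral_mul_busySeen_valuation p n hW hWn (f := fun _ _ => r)
    fun _ => measurable_const
  calc _ = ∫⁻ ω, W (inputAt U V S ω) * payAt p (seen p (inputAt U V S ω) n) (V n ω) ∂P :=
        lintegral_congr fun ω => (boole_mul _ _).symm
    _ ≤ ∫⁻ ω, W (inputAt U V S ω) * r ∂P := by
        rw [h1, h2]
        refine ENNReal.tsum_le_tsum fun k => ?_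
        refine mul_le_mul_right ?_ _
        simpa using h.lintegral_payAt_le hp p k
    _ = _ := by
        rw [mul_comm r]
        exact lintegral_mul_const _ (hW.comp h.measurable_inputAt)

/-- The elementary renewal theorem. -/
theorem IsServiceModel.tendsto_expected_arrivals_div (h : IsServiceModel P U V S lam mu) :
    Tendsto (fun t : ℝ≥0 => (∫⁻ ω, ∑' n,
      (if arrivalTime (fun i => U i ω) n ≤ t then (1 : ℝ≥0∞) else 0) ∂P) / t) atTop (𝓝 lam) := by
  have := h.isProbabilityMeasure
  have := h.tendsto_lintegral_tsum_div (π := fun _ _ => 1) (fun _ => measurable_const) (C := 1)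
    (fun _ _ => by simp) (ρ := 1) (tendsto_const_nhds.congr' ?_)
  · simpa using this
  · filter_upwards [eventually_gt_atTop 0] with N hN
    have : (N : ℝ≥0∞) ≠ 0 := by exact_mod_cast hN.ne'
    simp [ENNReal.div_self this]

theorem IsServiceModel.averageRevenue_le (h : IsServiceModel P U V S lam mu) {pInf : ℝ≥0}
    (hp : ∀ x : ℝ≥0, (x : ℝ≥0∞) * tailProb P (V 0) x ≤ pInf * tailProb P (V 0) pInf)
    (p : ℕ → ℝ≥0∞) (t : ℝ≥0) :
    averageRevenue P U V S p t ≤ pInf * tailProb P (V 0) pInf * ((∫⁻ ω, ∑' n,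
      (if arrivalTime (fun i => U i ω) n ≤ t then (1 : ℝ≥0∞) else 0) ∂P) / t) := by
  have hset := fun n => h.measurableSet_arrivalTime_le n t
  rw [averageRevenue_eq, ← mul_div_assoc]
  refine ENNReal.div_le_div_right ?_ _
  rw [lintegral_tsum fun n => (Measurable.ite (hset n) (h.measurable_payAt_seen p n)
      measurable_const).aemeasurable,
    lintegral_tsum fun n => (Measurable.ite (hset n) measurable_const
      measurable_const).aemeasurable, ← ENNReal.tsum_mul_left]
  exact ENNReal.tsum_le_tsum fun n => h.lintegral_payment_le hp p n t

theorem IsServiceModel.tendsto_bound (h : IsServiceModel P U V S lam mu) (pInf : ℝ≥0) :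
    Tendsto (fun t : ℝ≥0 => pInf * tailProb P (V 0) pInf * ((∫⁻ ω, ∑' n,
      (if arrivalTime (fun i => U i ω) n ≤ t then (1 : ℝ≥0∞) else 0) ∂P) / t)) atTop
      (𝓝 (lam * (pInf * tailProb P (V 0) pInf))) := by
  rw [mul_comm (lam : ℝ≥0∞)]
  exact ENNReal.Tendsto.const_mul h.tendsto_expected_arrivals_div
    (.inr (mul_tailProb_ne_top _ _))

/-- The infinite price confines the state to `0, …, K`, so the moments of order at most `K` suffice
and the finite-dimensional Cesàro lemma applies. -/
theorem IsServiceModel.exists_tendsto_cesaro_stateProb (h : IsServiceModel P U V S lam mu)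
    {p : ℕ → ℝ≥0∞} {K : ℕ} (hp : ∀ k, K ≤ k → p k = ∞) :
    ∃ a : Fin (K + 1) → ℝ≥0∞, ∀ k : Fin (K + 1), Tendsto (fun N : ℕ =>
      (∑ n ∈ Finset.range N, stateProb P U V S p n k) / N) atTop (𝓝 (a k)) := by
  have := h.isProbabilityMeasure
  have hfin : ∀ n k, stateProb P U V S p n k ≠ ∞ := fun n k => measure_ne_top _ _
  have hβ : ∀ r, surviveProb P U mu r ≤ 1 := fun r =>
    (lintegral_mono fun ω => pow_le_one' (expTail_le_one _ _) r).trans (by simp)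
  have hw : ∀ k r : ℕ, surviveProb P U mu r * ∫⁻ ω,
      ((k + if p k ≤ V 0 ω then 1 else 0).choose r : ℝ≥0∞) ∂P ≠ ∞ := by
    intro k r
    refine ENNReal.mul_ne_top (ne_top_of_le_ne_top ENNReal.one_ne_top (hβ r)) ?_
    refine ne_top_of_le_ne_top (b := (((k + 1).choose r : ℕ) : ℝ≥0∞)) (ENNReal.natCast_ne_top _)
      ((lintegral_mono (g := fun _ => (((k + 1).choose r : ℕ) : ℝ≥0∞)) fun ω => ?_).trans (by simp))
    refine Nat.cast_le.2 (Nat.choose_le_choose r ?_)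
    split_ifs <;> simp
  obtain ⟨a, ha⟩ := exists_tendsto_cesaro_of_choose_moments
    (fun n (k : Fin (K + 1)) => (stateProb P U V S p n k).toReal)
    (fun r k => (surviveProb P U mu r * ∫⁻ ω,
      (((k : ℕ) + if p k ≤ V 0 ω then 1 else 0).choose r : ℝ≥0∞) ∂P).toReal)
    (fun n k => by
      rw [abs_of_nonneg ENNReal.toReal_nonneg]
      exact ENNReal.toReal_le_of_le_ofReal zero_le_one (by
        rw [ENNReal.ofReal_one]; exact prob_le_one))
    (fun n r => by
      have := congrArg ENNReal.toReal (h.sum_choose_stateProb_succ hp n r)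
      rw [ENNReal.toReal_sum fun k _ => ENNReal.mul_ne_top (hfin _ _) (ENNReal.natCast_ne_top _),
        ENNReal.toReal_sum fun k _ => ENNReal.mul_ne_top (hfin _ _) (hw _ _)] at this
      simpa only [ENNReal.toReal_mul, ENNReal.toReal_natCast] using this)
  refine ⟨fun k => ENNReal.ofReal (a k), fun k => ?_⟩
  refine (ENNReal.tendsto_ofReal (ha k)).congr' ?_
  filter_upwards [eventually_gt_atTop 0] with N hN
  rw [ENNReal.ofReal_mul (by positivity), ENNReal.ofReal_inv_of_pos (by positivity),
    ENNReal.ofReal_natCast, ← ENNReal.toReal_sum fun n _ => hfin n k,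
    ENNReal.ofReal_toReal (ENNReal.sum_ne_top.2 fun n _ => hfin n k), ENNReal.div_eq_inv_mul]

theorem IsServiceModel.exists_tendsto_cesaro_payment (h : IsServiceModel P U V S lam mu)
    {p : ℕ → ℝ≥0∞} {K : ℕ} (hp : ∀ k, K ≤ k → p k = ∞) :
    ∃ ρ, Tendsto (fun N : ℕ => (∑ n ∈ Finset.range N,
      ∫⁻ ω, payAt p (seen p (inputAt U V S ω) n) (V n ω) ∂P) / N) atTop (𝓝 ρ) := by
  have := h.isProbabilityMeasure
  obtain ⟨a, ha⟩ := h.exists_tendsto_cesaro_stateProb hp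
  refine ⟨∑ k : Fin (K + 1), a k * ∫⁻ ω, payAt p k (V 0 ω) ∂P, ?_⟩
  have hlim := tendsto_finsetSum Finset.univ fun (k : Fin (K + 1)) _ =>
    ENNReal.Tendsto.mul_const (ha k) (.inr (lintegral_payAt_ne_top (P := P) (V := V) p k))
  refine hlim.congr fun N => ?_
  simp only [h.lintegral_busySeen_valuation hp _ (measurable_payAt p)]
  rw [Finset.sum_comm, div_eq_mul_inv, Finset.sum_mul]
  refine Finset.sum_congr rfl fun k _ => ?_
  rw [← Finset.sum_mul, div_eq_mul_inv, mul_right_comm]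

theorem finitePrices_of_le {K : ℕ} (p : Fin K → ℝ≥0) {k : ℕ} (hk : K ≤ k) :
    finitePrices K p k = ∞ := by
  rw [finitePrices, dif_neg (not_lt.2 hk)]

theorem payAt_finitePrices_le {K : ℕ} (p : Fin K → ℝ≥0) (k : ℕ) (x : ℝ≥0) :
    payAt (finitePrices K p) k x ≤ (∑ i, p i : ℝ≥0) := by
  by_cases hk : k < K
  · unfold payAt
    split_ifs
    · rw [finitePrices, dif_pos hk]
      exact ENNReal.coe_le_coe.2 (Finset.single_le_sum (fun _ _ => zero_le) (Finset.mem_univ _))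
    · exact zero_le
  · rw [payAt_top (finitePrices_of_le p (not_lt.1 hk))]
    exact zero_le

/-- The revenue rate of a finite system exists, and is the arrival rate times the long-run mean
payment per customer. -/
theorem IsServiceModel.exists_tendsto_averageRevenue (h : IsServiceModel P U V S lam mu) (K : ℕ)
    (p : Fin K → ℝ≥0) :
    ∃ ρ, Tendsto (fun N : ℕ => (∑ n ∈ Finset.range N, ∫⁻ ω, payAt (finitePrices K p)
        (seen (finitePrices K p) (inputAt U V S ω) n) (V n ω) ∂P) / N) atTop (𝓝 ρ) ∧
      Tendsto (averageRevenue P U V S (finitePrices K p)) atTop (𝓝 (lam * ρ)) ∧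
      revenueRate P U V S K p = lam * ρ := by
  obtain ⟨ρ, hρ⟩ := h.exists_tendsto_cesaro_payment (fun k hk => finitePrices_of_le p hk)
  have := h.tendsto_lintegral_tsum_div (h.measurable_payAt_seen (finitePrices K p))
    (fun n ω => payAt_finitePrices_le p _ _) hρ
  exact ⟨ρ, hρ, this, Tendsto.limUnder_eq this⟩

end Revenue

/-! ### Many and infinitely many servers -/

section LargeSystems

variable {Ω : Type*} [MeasurableSpace Ω] {P : Measure Ω} {U V S : ℕ → Ω → ℝ≥0} {lam mu : ℝ≥0}

/-- Equality would force `exp (-μ U) = 1` almost surely, hence U = 0, contradicting the positive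
mean. -/
theorem IsServiceModel.surviveProb_one_lt (h : IsServiceModel P U V S lam mu) :
    surviveProb P U mu 1 < 1 := by
  have := h.isProbabilityMeasure
  have hm : Measurable fun ω => expTail mu (U 0 ω) :=
    (measurable_expTail mu).comp (h.measurable_interarrival 0)
  have hle : surviveProb P U mu 1 ≤ 1 :=
    (lintegral_mono fun ω => pow_le_one' (expTail_le_one _ _) 1).trans (by simp)
  refine hle.lt_of_ne fun heq => ?_
  simp only [surviveProb, pow_one] at heq
  have hzero : ∫⁻ ω, (1 - expTail mu (U 0 ω)) ∂P = 0 := by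
    rw [lintegral_sub hm (by simp [heq]) (ae_of_all _ fun ω => expTail_le_one _ _), heq]
    simp
  replace hzero := (lintegral_eq_zero_iff (measurable_const.sub hm)).1 hzero
  have hU : ∫⁻ ω, (U 0 ω : ℝ≥0∞) ∂P = 0 := by
    rw [lintegral_eq_zero_iff (h.measurable_interarrival 0).coe_nnreal_ennreal]
    filter_upwards [hzero] with ω hω
    have h1 : 1 ≤ expTail mu (U 0 ω) := tsub_eq_zero_iff_le.1 hω
    rw [expTail, ENNReal.one_le_ofReal, Real.one_le_exp_iff] at h1
    have h2 : (mu : ℝ) * U 0 ω ≤ 0 := by linarith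
    have hmu : (0 : ℝ) < mu := h.mu_pos
    have h3 : (U 0 ω : ℝ) ≤ 0 := by
      by_contra hpos
      exact absurd h2 (not_le.2 (mul_pos hmu (not_le.1 hpos)))
    have : U 0 ω = 0 := le_antisymm (by exact_mod_cast h3) zero_le
    simp [this]
  rw [h.mean_interarrival] at hU
  simp at hU

/-- The expected number of busy servers is bounded uniformly in time and in the prices. -/
theorem IsServiceModel.lintegral_busySeen_le (h : IsServiceModel P U V S lam mu)
    (p : ℕ → ℝ≥0∞) (n : ℕ) :
    ∫⁻ ω, (seen p (inputAt U V S ω) n : ℝ≥0∞) ∂P ≤ (1 - surviveProb P U mu 1)⁻¹ := by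
  have := h.isProbabilityMeasure
  have hlt := h.surviveProb_one_lt
  have hrec := fun n => h.lintegral_choose_busySeen_succ p n 1
  simp only [Nat.choose_one_right] at hrec
  set β := surviveProb P U mu 1
  induction n with
  | zero =>
    have : ∀ ω, seen p (inputAt U V S ω) 0 = 0 := fun ω => by
      rw [seen, busySeen_eq_sum_range]; simp
    simp [this]
  | succ n ih =>
    have hne : 1 - β ≠ 0 := (tsub_pos_of_lt hlt).ne'
    have hfin : 1 - β ≠ ∞ := by finiteness
    rw [hrec]
    have hstep : ∫⁻ ω, ((seen p (inputAt U V S ω) n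
        + if p (seen p (inputAt U V S ω) n) ≤ V n ω then 1 else 0 : ℕ) : ℝ≥0∞) ∂P
        ≤ (1 - β)⁻¹ + 1 := by
      calc _ ≤ ∫⁻ ω, ((seen p (inputAt U V S ω) n : ℝ≥0∞) + 1) ∂P := by
            refine lintegral_mono fun ω => ?_
            push_cast
            gcongr
            split_ifs <;> simp
        _ = ∫⁻ ω, (seen p (inputAt U V S ω) n : ℝ≥0∞) ∂P + 1 := by
            rw [lintegral_add_right _ measurable_const]; simp
        _ ≤ (1 - β)⁻¹ + 1 := by gcongr
    -- The bound is not sharp: the last `β` is relaxed to 1 so that the two terms recombine to `(1 -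
    -- β)⁻¹`.
    calc _ ≤ β * ((1 - β)⁻¹ + 1) := by gcongr
      _ ≤ β * (1 - β)⁻¹ + 1 := by rw [mul_add, mul_one]; gcongr
      _ = (β + (1 - β)) * (1 - β)⁻¹ := by rw [add_mul, ENNReal.mul_inv_cancel hne hfin]
      _ = (1 - β)⁻¹ := by rw [add_tsub_cancel_of_le hlt.le, one_mul]

/-- Markov's inequality. Taken at the number of servers, it bounds the blocking probability
uniformly in `n`; for `K = 0` the right side is `∞`. -/
theorem IsServiceModel.stateProb_le (h : IsServiceModel P U V S lam mu)
    (p : ℕ → ℝ≥0∞) (n K : ℕ) :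
    stateProb P U V S p n K ≤ (1 - surviveProb P U mu 1)⁻¹ / K := by
  have := h.isProbabilityMeasure
  have hb : (1 - surviveProb P U mu 1)⁻¹ ≠ 0 := by
    rw [Ne, ENNReal.inv_eq_zero]; finiteness
  refine ENNReal.le_div_iff_mul_le (.inr hb) (.inl (ENNReal.natCast_ne_top K)) |>.2 ?_
  refine le_trans ?_ (h.lintegral_busySeen_le p n)
  rw [mul_comm]
  have hm : Measurable fun ω => (seen p (inputAt U V S ω) n : ℝ≥0∞) :=
    (Measurable.of_discrete (f := fun k : ℕ => (k : ℝ≥0∞))).comp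
      ((measurable_seen p n).comp h.measurable_inputAt)
  refine le_trans ?_ (mul_meas_ge_le_lintegral hm (K : ℝ≥0∞))
  refine mul_le_mul_right (measure_mono fun ω hω => ?_) _
  have : seen p (inputAt U V S ω) n = K := hω
  exact (congrArg (Nat.cast (R := ℝ≥0∞)) this).ge

/-- Under a uniform price only the blocking probability is lost. -/
theorem IsServiceModel.lintegral_payment_uniform (h : IsServiceModel P U V S lam mu) (K : ℕ)
    (x : ℝ≥0) (n : ℕ) :
    ∫⁻ ω, payAt (finitePrices K fun _ => x)
        (seen (finitePrices K fun _ => x) (inputAt U V S ω) n) (V n ω) ∂P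
      + stateProb P U V S (finitePrices K fun _ => x) n K * (x * tailProb P (V 0) x)
      = x * tailProb P (V 0) x := by
  have := h.isProbabilityMeasure
  set p := finitePrices K fun _ => x with hp
  have hpK : ∀ k, K ≤ k → p k = ∞ := fun k hk => finitePrices_of_le _ hk
  have hone : ∑ k : Fin (K + 1), stateProb P U V S p n k = 1 := by
    have := h.lintegral_busySeen_valuation hpK n (f := fun _ _ => 1) fun _ => measurable_const
    simpa using this.symm
  rw [h.lintegral_busySeen_valuation hpK n (measurable_payAt p), Fin.sum_univ_castSucc]
  rw [Fin.sum_univ_castSucc] at hone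
  have hlast : ∫⁻ ω, payAt p (Fin.last K : ℕ) (V 0 ω) ∂P = 0 := by
    simp [payAt_top (hpK K le_rfl)]
  have hlt : ∀ k : Fin K, ∫⁻ ω, payAt p (k.castSucc : ℕ) (V 0 ω) ∂P
      = x * tailProb P (V 0) x := fun k =>
    h.lintegral_payAt_coe (by simp [hp, finitePrices])
  simp only [hlt, hlast, mul_zero, add_zero]
  rw [← Finset.sum_mul, ← add_mul]
  conv_rhs => rw [← one_mul ((x : ℝ≥0∞) * tailProb P (V 0) x), ← hone]
  simp

theorem IsServiceModel.le_revenueRate_uniform (h : IsServiceModel P U V S lam mu) (K : ℕ)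
    (x : ℝ≥0) :
    lam * (x * tailProb P (V 0) x
        - (1 - surviveProb P U mu 1)⁻¹ / K * (x * tailProb P (V 0) x))
      ≤ revenueRate P U V S K fun _ => x := by
  obtain ⟨ρ, hρ, -, hrate⟩ := h.exists_tendsto_averageRevenue K fun _ => x
  rw [hrate]
  gcongr
  refine ge_of_tendsto hρ ?_
  filter_upwards [eventually_gt_atTop 0] with N hN
  rw [ENNReal.le_div_iff_mul_le (.inl (by exact_mod_cast hN.ne'))
    (.inl (ENNReal.natCast_ne_top N)), mul_comm, ← nsmul_eq_mul]
  conv_lhs => rw [← Finset.card_range N]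
  refine Finset.card_nsmul_le_sum _ _ _ fun n _ => ?_
  rw [tsub_le_iff_right]
  conv_lhs => rw [← h.lintegral_payment_uniform K x n]
  gcongr
  exact h.stateProb_le _ n K

theorem IsServiceModel.revenueRate_le (h : IsServiceModel P U V S lam mu) {pInf : ℝ≥0}
    (hp : ∀ x : ℝ≥0, (x : ℝ≥0∞) * tailProb P (V 0) x ≤ pInf * tailProb P (V 0) pInf)
    (K : ℕ) (p : Fin K → ℝ≥0) :
    revenueRate P U V S K p ≤ lam * (pInf * tailProb P (V 0) pInf) := by
  obtain ⟨ρ, -, hlim, hrate⟩ := h.exists_tendsto_averageRevenue K p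
  rw [hrate]
  exact le_of_tendsto_of_tendsto' hlim (h.tendsto_bound pInf) (h.averageRevenue_le hp _)

theorem IsServiceModel.tendsto_lower_bound (h : IsServiceModel P U V S lam mu) (x : ℝ≥0) :
    Tendsto (fun K : ℕ => (lam : ℝ≥0∞) * (x * tailProb P (V 0) x
      - (1 - surviveProb P U mu 1)⁻¹ / K * (x * tailProb P (V 0) x))) atTop
      (𝓝 (lam * (x * tailProb P (V 0) x))) := by
  have hb : (1 - surviveProb P U mu 1)⁻¹ ≠ ∞ := by
    rw [ENNReal.inv_ne_top]
    exact (tsub_pos_of_lt h.surviveProb_one_lt).ne'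
  have h1 : Tendsto (fun K : ℕ => (1 - surviveProb P U mu 1)⁻¹ / K) atTop (𝓝 0) := by
    simpa using ENNReal.Tendsto.const_div ENNReal.tendsto_nat_nhds_top (.inr hb)
  have h2 := ENNReal.Tendsto.mul_const h1 (.inr (mul_tailProb_ne_top (P := P) (V 0) x))
  have h3 := ENNReal.Tendsto.sub (tendsto_const_nhds (x := (x : ℝ≥0∞) * tailProb P (V 0) x)) h2
    (.inl (mul_tailProb_ne_top _ _))
  have h4 := ENNReal.Tendsto.const_mul h3 (.inr (ENNReal.coe_ne_top (r := lam)))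
  simpa using h4

/-- With a constant price and no blocking the payment depends on the valuation alone, so every
customer has the same mean payment and no ergodic argument is needed. -/
theorem IsServiceModel.tendsto_averageRevenue_infinite (h : IsServiceModel P U V S lam mu)
    (x : ℝ≥0) :
    Tendsto (averageRevenue P U V S (infinitePrices fun _ => x)) atTop
      (𝓝 (lam * (x * tailProb P (V 0) x))) := by
  have := h.isProbabilityMeasure
  have hpay : ∀ n, ∫⁻ ω, payAt (infinitePrices fun _ => x)
      (seen (infinitePrices fun _ => x) (inputAt U V S ω) n) (V n ω) ∂P
      = x * tailProb P (V 0) x := by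
    intro n
    rw [← h.lintegral_payAt_coe (p := infinitePrices fun _ => x) (k := 0) rfl]
    exact ((h.identDistrib_valuation n).comp
      (measurable_payAt (infinitePrices fun _ => x) 0)).lintegral_eq
  refine h.tendsto_lintegral_tsum_div (C := x) (h.measurable_payAt_seen _) (fun n ω => ?_)
    (tendsto_const_nhds.congr' ?_)
  · unfold payAt
    split_ifs
    · exact le_rfl
    · exact zero_le
  · filter_upwards [eventually_gt_atTop 0] with N hN
    simp only [hpay, Finset.sum_const, Finset.card_range, nsmul_eq_mul]
    rw [mul_comm (N : ℝ≥0∞), mul_div_assoc, ENNReal.div_self (by exact_mod_cast hN.ne')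
      (ENNReal.natCast_ne_top N), mul_one]

end LargeSystems

theorem mainTheorem9 {Ω : Type*} [MeasurableSpace Ω] (P : Measure Ω) [IsProbabilityMeasure P]
    (U V S : ℕ → Ω → ℝ≥0) (lam mu : ℝ≥0) (hmodel : IsServiceModel P U V S lam mu) :
    -- an optimal uniform price for infinitely many servers exists
    (∃ pInf : ℝ≥0, ∀ x : ℝ≥0, (x : ℝ≥0∞) * tailProb P (V 0) x ≤ pInf * tailProb P (V 0) pInf) ∧
    -- the limit that defines the revenue rate of a finite system exists
    (∀ (K : ℕ) (p : Fin K → ℝ≥0),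
      Tendsto (averageRevenue P U V S (finitePrices K p)) atTop
        (𝓝 (revenueRate P U V S K p))) ∧
    ∀ pInf : ℝ≥0,
      (∀ x : ℝ≥0, (x : ℝ≥0∞) * tailProb P (V 0) x ≤ pInf * tailProb P (V 0) pInf) →
      -- the bound for every finite system and every price vector
      (∀ (K : ℕ) (p : Fin K → ℝ≥0),
        revenueRate P U V S K p ≤ lam * (pInf * tailProb P (V 0) pInf)) ∧
      -- the revenue rate under the uniform price, and the optimal one, approach the bound
      Tendsto (fun K : ℕ => revenueRate P U V S K (fun _ => pInf)) atTop
        (𝓝 (lam * (pInf * tailProb P (V 0) pInf))) ∧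
      Tendsto (fun K : ℕ => ⨆ p : Fin K → ℝ≥0, revenueRate P U V S K p) atTop
        (𝓝 (lam * (pInf * tailProb P (V 0) pInf))) ∧
      -- in the system with infinitely many servers the uniform price attains the bound, and
      -- no state-dependent prices exceed it
      Tendsto (averageRevenue P U V S (infinitePrices fun _ => pInf)) atTop
        (𝓝 (lam * (pInf * tailProb P (V 0) pInf))) ∧
      (∀ p : ℕ → ℝ≥0,
        limsup (averageRevenue P U V S (infinitePrices p)) atTop
          ≤ lam * (pInf * tailProb P (V 0) pInf)) := by
  refine ⟨hmodel.exists_forall_mul_tailProb_le, fun K p => ?_, fun pInf hp => ?_⟩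
  · obtain ⟨ρ, -, hlim, hrate⟩ := hmodel.exists_tendsto_averageRevenue K p
    rwa [hrate]
  · have hle := hmodel.revenueRate_le hp
    have hlow := hmodel.le_revenueRate_uniform (x := pInf)
    have hlim := hmodel.tendsto_lower_bound pInf
    refine ⟨hle, tendsto_of_tendsto_of_tendsto_of_le_of_le hlim tendsto_const_nhds hlow
        fun K => hle K _,
      tendsto_of_tendsto_of_tendsto_of_le_of_le hlim tendsto_const_nhds
        (fun K => (hlow K).trans (le_iSup (fun p => revenueRate P U V S K p) fun _ => pInf))
        fun K => iSup_le (hle K),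
      hmodel.tendsto_averageRevenue_infinite pInf, fun p => ?_⟩
    -- Convergence is not claimed for state-dependent prices; the bound holds at each `t`, which
    -- suffices for the limit superior.
    rw [← (hmodel.tendsto_bound pInf).limsup_eq]
    exact limsup_le_limsup (.of_forall (hmodel.averageRevenue_le hp _))
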